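/- Let $\mathbb D$ be the open unit disk and $H^2$ the Hardy space of $f(z)=\sum_{n\ge0}a_nz^n$ with $\|f\|^2=\sum|a_n|^2<\infty$. For a bounded operator $T$ put $a_n(T)=\inf\{\|T-R\| : \operatorname{rank}R<n\}$, $n\ge1$. A modulus of continuity is a continuous, strictly increasing, sub-additive function $\omega:[0,A]\to\mathbb R^+$ ($A>0$) with $\omega(0)=0$; its inverse is $\omega^{-1}:[0,\omega(A)]\to[0,A]$. Let $\phi:\overline{\mathbb D}\to\mathbb C$ be continuous, analytic in $\mathbb D$, with $\phi(\mathbb D)\subseteq\mathbb D$, and suppose $\phi(\overline{\mathbb D})\cap\partial\mathbb D=\{\xi_1,\dots,\xi_p\}$ with $\xi_1,\dots,\xi_p$ distinct. Put $\gamma(t)=\phi(e^{it})$ for $t\in\mathbb R$ and $E_{\xi_j}=\{t\in\mathbb R : \gamma(t)=\xi_j\}$. Let $\omega:[0,A]\to\mathbb R^+$ be a modulus of continuity with $\lim_{h\to0^+}\omega(h)/h=\infty$, and suppose that $\phi$ is globally regular with respect to $\omega$: there are $r_1,\dots,r_p\in(0,A]$ and $C,c>0$ such that $\mathbb R=\bigcup_{j=1}^p\big(E_{\xi_j}+[-r_j,r_j]\big)$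 and, for all $j$, all $t_j\in E_{\xi_j}$ and all real $t$ with $|t-t_j|\le r_j$, $$|\gamma(t)-\gamma(t_j)|\le C\,(1-|\gamma(t)|)\qquad\text{and}\qquad c\,\omega(|t-t_j|)\le|\gamma(t)-\gamma(t_j)|.$$ Then $C_\phi:f\mapsto f\circ\phi$ is a bounded operator on $H^2$, and there are constants $\sigma,K>0$ and $0<\kappa\le\omega(A)$ such that, with $$d_N=\Big\lfloor\sigma\log\frac{\kappa2^{-N}}{\omega^{-1}(\kappa2^{-N})}\Big\rfloor+1$$ and with $N_q$ the largest integer $N\ge1$ such that $p\,N\,d_N<q$ ($N_q=1$ if there is none), $N_q$ is well defined and $$a_q(C_\phi)\le K\sqrt{\frac{\omega^{-1}(\kappa2^{-N_q})}{\kappa2^{-N_q}}}\qquad\text{for every } q\ge1.$$ In particular: - if $\omega(h)=h^\theta$ for all small $h>0$, where $0<\theta<1$, then there are $a,\beta>0$ with $a_n(C_\phi)\le a\,e^{-\beta\sqrt n}$ for all $n\ge1$; - if $\omega(h)=1/(\log(1/h))^\alpha$ for all small $h>0$, where $0<\alpha\le1$, then there are $a,\beta>0$ with $a_n(C_\phi)\le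 a\,e^{-\beta n/\log n}$ for all $n\ge2$. -/

import Mathlib

open Set Filter Topology

noncomputable section

/-- The Hardy space `H²` of the unit disk, each function being given by its sequence of Taylor
coefficients: `f(z) = ∑ aₙ zⁿ` with `‖f‖² = ∑ |aₙ|² < ∞`. -/
abbrev HardyH2 : Type := lp (fun _ : ℕ => ℂ) 2

/-- The value at `z` (with `|z| < 1`) of the function `f ∈ H²`. -/
def HardyH2.eval (f : HardyH2) (z : ℂ) : ℂ := ∑' n : ℕ, f n * z ^ n

/-- The power series of an `H²` function converges (absolutely) in the unit disk. -/
theorem HardyH2.hasSum_eval (f : HardyH2) {z : ℂ} (hz : ‖z‖ < 1) :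
    HasSum (fun n : ℕ => f n * z ^ n) (f.eval z) := by
  refine Summable.hasSum (Summable.of_norm_bounded (g := fun n => ‖f‖ * ‖z‖ ^ n)
    ((summable_geometric_of_lt_one (norm_nonneg z) hz).mul_left _) fun n => ?_)
  rw [norm_mul, norm_pow]
  exact mul_le_mul_of_nonneg_right (lp.norm_apply_le_norm (by norm_num) f n) (by positivity)

/-- An element of `H²` is determined by its values in the unit disk. -/
theorem HardyH2.eval_injective {f g : HardyH2}
    (h : ∀ z : ℂ, ‖z‖ < 1 → f.eval z = g.eval z) : f = g := by
  have key : ∀ u : HardyH2, HasFPowerSeriesAt (HardyH2.eval u)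
      (FormalMultilinearSeries.ofScalars ℂ (fun n => u n)) 0 := by
    intro u
    rw [hasFPowerSeriesAt_iff]
    filter_upwards [Metric.ball_mem_nhds (0 : ℂ) one_pos] with z hz
    have hz' : ‖z‖ < 1 := by simpa using hz
    simpa [mul_comm, FormalMultilinearSeries.coeff_ofScalars] using HardyH2.hasSum_eval u hz'
  have he : HardyH2.eval f =ᶠ[𝓝 0] HardyH2.eval g := by
    filter_upwards [Metric.ball_mem_nhds (0 : ℂ) one_pos] with z hz
    exact h z (by simpa using hz)
  have := (key f).eq_formalMultilinearSeries_of_eventually (key g) he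
  ext n
  have h2 := congrArg (fun q => FormalMultilinearSeries.coeff q n) this
  simpa [FormalMultilinearSeries.coeff_ofScalars] using h2

/-- `T` is the composition operator `C_φ : f ↦ f ∘ φ` on `H²`, as a bounded operator. -/
def IsCompositionOperator (φ : ℂ → ℂ) (T : HardyH2 →L[ℂ] HardyH2) : Prop :=
  ∀ (f : HardyH2) (z : ℂ), ‖z‖ < 1 → (T f).eval z = f.eval (φ z)

/-- There is at most one composition operator of symbol `φ`. -/
theorem IsCompositionOperator.unique {φ : ℂ → ℂ} {S T : HardyH2 →L[ℂ] HardyH2}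
    (hS : IsCompositionOperator φ S) (hT : IsCompositionOperator φ T) : S = T :=
  ContinuousLinearMap.ext fun f =>
    HardyH2.eval_injective fun z hz => (hS f z hz).trans (hT f z hz).symm

/-- The `n`-th approximation number `a_n(T) = inf {‖T - R‖ : rank R < n}`, `n ≥ 1`, of a bounded
operator. -/
def approxNumber {E F : Type*} [NormedAddCommGroup E] [NormedSpace ℂ E]
    [NormedAddCommGroup F] [NormedSpace ℂ F] (n : ℕ) (T : E →L[ℂ] F) : ℝ :=
  sInf {x : ℝ | ∃ R : E →L[ℂ] F,
    LinearMap.rank (R : E →ₗ[ℂ] F) < (n : Cardinal) ∧ x = ‖T - R‖}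

/-- A symbol in the disk algebra: an analytic self-map of the open unit disk that extends
continuously to the closed disk. -/
structure IsDiskAlgebraSymbol (φ : ℂ → ℂ) : Prop where
  continuousOn : ContinuousOn φ (Metric.closedBall 0 1)
  differentiableOn : DifferentiableOn ℂ φ (Metric.ball 0 1)
  mapsTo : MapsTo φ (Metric.ball 0 1) (Metric.ball 0 1)

/-- The boundary curve `γ(t) = φ(e^{it})`, a `2π`-periodic function of the real variable `t`. -/
def boundaryCurve (φ : ℂ → ℂ) (t : ℝ) : ℂ := φ (Complex.exp (t * Complex.I))

/-- `ω : [0, A] → ℝ⁺` is a modulus of continuity. -/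
structure IsModulusOfContinuity (A : ℝ) (ω : ℝ → ℝ) : Prop where
  pos : 0 < A
  continuousOn : ContinuousOn ω (Icc 0 A)
  strictMonoOn : StrictMonoOn ω (Icc 0 A)
  map_zero : ω 0 = 0
  subadditive : ∀ x y : ℝ, 0 ≤ x → 0 ≤ y → x + y ≤ A → ω (x + y) ≤ ω x + ω y

/-- The inverse `ω⁻¹ : [0, ω(A)] → [0, A]`. -/
def modulusInv (A : ℝ) (ω : ℝ → ℝ) : ℝ → ℝ := Function.invFunOn ω (Icc 0 A)

/-- `φ` is globally regular at the contact points `ξ₁, …, ξ_p`, with modulus of continuity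
`ω : [0, A] → ℝ⁺`. Real parameters `t` are used for points `e^{it}` of the circle, so the
covering of the circle by the arcs `E_{ξ_j} + [-r_j, r_j]` is a covering of the real line. -/
def IsGloballyRegular (φ : ℂ → ℂ) {p : ℕ} (ξ : Fin p → ℂ) (A : ℝ) (ω : ℝ → ℝ) : Prop :=
  ∃ r : Fin p → ℝ, (∀ j, 0 < r j ∧ r j ≤ A) ∧
    (∀ t : ℝ, ∃ j, ∃ s : ℝ, boundaryCurve φ s = ξ j ∧ |t - s| ≤ r j) ∧
    ∃ C > 0, ∃ c > 0, ∀ (j : Fin p) (s t : ℝ), boundaryCurve φ s = ξ j → |t - s| ≤ r j →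
      ‖boundaryCurve φ t - boundaryCurve φ s‖ ≤ C * (1 - ‖boundaryCurve φ t‖) ∧
      c * ω |t - s| ≤ ‖boundaryCurve φ t - boundaryCurve φ s‖

/-- `d_N = [σ log (κ 2^{-N} / ω⁻¹(κ 2^{-N}))] + 1`. -/
def dNumber (A : ℝ) (ω : ℝ → ℝ) (σ κ : ℝ) (N : ℕ) : ℤ :=
  ⌊σ * Real.log ((κ / 2 ^ N) / modulusInv A ω (κ / 2 ^ N))⌋ + 1

/-- `N = N_q`: `N` is the largest integer `N ≥ 1` with `p N d_N < q`, and `N = 1` if there is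
no such integer. -/
def IsNq (p : ℕ) (d : ℕ → ℤ) (q N : ℕ) : Prop :=
  IsGreatest {M : ℕ | 1 ≤ M ∧ (p : ℤ) * M * d M < q} N ∨
    ({M : ℕ | 1 ≤ M ∧ (p : ℤ) * M * d M < q} = ∅ ∧ N = 1)

end

/-! If `B` is a finite Blaschke product of degree less than `q`, then up to an operator of rank less
than `q` the operator `T = C_φ` factors through multiplication by `B`, so `a_q(T) ≤ ‖T M_B‖`. Now `T
M_B f = (B ∘ φ)(f ∘ φ)`, and its norm is governed by a Carleson embedding for the weight `|B ∘ φ|²`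
on the circle. A radial condition suffices here: if the weight has mass at most `ε r` on `{1 - |γ| ≤
r}` for every `r`, then its moments against `|γ|^k` are `O(ε / (k + 1))`, and Hilbert's inequality
gives `‖T M_B‖² = O(ε)`.

The product has zeros `(1 - δ 2⁻ⁿ) ξ_j`, `1 ≤ n ≤ N`, each repeated `d` times. Global regularity
keeps `γ` in Stolz angles at the `ξ_j`. Hence wherever `1 - |γ| ≥ δ 2⁻ᴺ` one of the zeros lies at
bounded pseudo-hyperbolic distance from `γ`, and `|B ∘ φ|² ≤ θ^d` with a fixed `θ < 1`. Closer to
the circle only `|B| ≤ 1` is used, but there the curve spends little time: `{1 - |γ| ≤ r}` is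
covered by finitely many intervals of radius `ω⁻¹(L r)`, and `ω⁻¹(y) / y` is increasing up to a
factor `2` by sub-additivity. With `ε_N = ω⁻¹(κ 2⁻ᴺ) / (κ 2⁻ᴺ)`, both contributions are `O(ε_N r)`
as soon as `θ^d ≤ ε_N`, which is what `d = d_N` ensures. The degree is `p N d_N`, whence the
definition of `N_q`.

For the two special moduli `ω⁻¹` is explicit: `p N d_N` grows at most like `N²` or `N Λ^N`, and
inverting this relation gives the two rates. -/

noncomputable section

/-! ### Monomials and bounded operators on `H²` -/

namespace HardyH2

/-- The monomial `z ^ k` as an element of `H²`. -/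
def monomial (k : ℕ) : HardyH2 := lp.single 2 k (1 : ℂ)

theorem monomial_apply (k n : ℕ) : monomial k n = if n = k then 1 else 0 := by
  rw [monomial, lp.single_apply, Pi.single_apply]

theorem eval_monomial (k : ℕ) (z : ℂ) : (monomial k).eval z = z ^ k := by
  rw [HardyH2.eval, tsum_eq_single k]
  · simp [monomial_apply]
  · intro n hn
    simp [monomial_apply, hn]

theorem hasSum_norm_sq (f : HardyH2) : HasSum (fun n => ‖f n‖ ^ 2) (‖f‖ ^ 2) := by
  have := lp.hasSum_norm (p := 2) (by norm_num) f
  simpa using this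

theorem hasSum_monomial (f : HardyH2) : HasSum (fun k => f k • monomial k) f := by
  have := lp.hasSum_single (p := 2) (by norm_num) f
  refine (funext fun k => ?_ : (fun k => f k • monomial k) = _) ▸ this
  simp [monomial, ← lp.single_smul]

theorem eval_add (f g : HardyH2) {z : ℂ} (hz : ‖z‖ < 1) :
    (f + g).eval z = f.eval z + g.eval z := by
  refine HasSum.unique (hasSum_eval (f + g) hz) ?_
  simpa [add_mul] using (hasSum_eval f hz).add (hasSum_eval g hz)

theorem eval_smul (c : ℂ) (f : HardyH2) {z : ℂ} (hz : ‖z‖ < 1) :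
    (c • f).eval z = c * f.eval z := by
  refine HasSum.unique (hasSum_eval (c • f) hz) ?_
  simpa [mul_assoc] using (hasSum_eval f hz).mul_left c

theorem norm_eval_le (f : HardyH2) {z : ℂ} (hz : ‖z‖ < 1) :
    ‖f.eval z‖ ≤ (1 - ‖z‖)⁻¹ * ‖f‖ := by
  refine tsum_of_norm_bounded ((hasSum_geometric_of_lt_one (norm_nonneg z) hz).mul_right ‖f‖)
    fun n => ?_
  rw [norm_mul, norm_pow, mul_comm]
  exact mul_le_mul_of_nonneg_left (lp.norm_apply_le_norm (by norm_num) f n) (by positivity)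

/-- Evaluation at a point of the disk, as a continuous linear functional. -/
def evalCLM {z : ℂ} (hz : ‖z‖ < 1) : HardyH2 →L[ℂ] ℂ :=
  LinearMap.mkContinuous
    { toFun := fun f => f.eval z
      map_add' := fun f g => eval_add f g hz
      map_smul' := fun c f => eval_smul c f hz }
    (1 - ‖z‖)⁻¹ fun f => norm_eval_le f hz

theorem evalCLM_apply {z : ℂ} (hz : ‖z‖ < 1) (f : HardyH2) : evalCLM hz f = f.eval z := rfl

theorem clm_ext {E : Type*} [NormedAddCommGroup E] [NormedSpace ℂ E] {S T : HardyH2 →L[ℂ] E}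
    (h : ∀ k, S (monomial k) = T (monomial k)) : S = T := by
  ext f
  have hS := (hasSum_monomial f).mapL S
  have hT := (hasSum_monomial f).mapL T
  simp only [map_smul] at hS hT
  simp only [h] at hS
  exact hS.unique hT

/-- The partial sums of the monomial expansion converge, so a bound on polynomials passes to the
limit. -/
theorem norm_clm_le {E : Type*} [NormedAddCommGroup E] [NormedSpace ℂ E] (T : HardyH2 →L[ℂ] E)
    {M : ℝ} (hM : 0 ≤ M)
    (h : ∀ (s : Finset ℕ) (c : ℕ → ℂ),
      ‖∑ k ∈ s, c k • T (monomial k)‖ ^ 2 ≤ M * ∑ k ∈ s, ‖c k‖ ^ 2) :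
    ‖T‖ ≤ √M := by
  refine T.opNorm_le_bound (Real.sqrt_nonneg M) fun f => ?_
  refine abs_le_of_sq_le_sq' ?_ (by positivity) |>.2
  rw [mul_pow, Real.sq_sqrt hM]
  have hT := (hasSum_monomial f).mapL T
  simp only [map_smul] at hT
  refine le_of_tendsto_of_tendsto ((continuous_norm.pow 2).continuousAt.tendsto.comp hT)
    ((hasSum_norm_sq f).mul_left M) (Eventually.of_forall fun s => ?_)
  simpa [Finset.mul_sum] using h s f

/-- A sequence of vectors that is dominated by an orthonormal sequence is the image of the
monomials under a bounded operator. -/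
theorem exists_clm {E : Type*} [NormedAddCommGroup E] [NormedSpace ℂ E] [CompleteSpace E]
    (v : ℕ → E) {M : ℝ} (hM : 0 ≤ M)
    (h : ∀ (s : Finset ℕ) (c : ℕ → ℂ),
      ‖∑ k ∈ s, c k • v k‖ ^ 2 ≤ M * ∑ k ∈ s, ‖c k‖ ^ 2) :
    ∃ T : HardyH2 →L[ℂ] E, ∀ k, T (monomial k) = v k := by
  have hsum : ∀ f : HardyH2, Summable fun k => f k • v k := by
    intro f
    rw [summable_iff_vanishing_norm]
    intro ε hε
    obtain ⟨s, hs⟩ := summable_iff_vanishing_norm.1 (hasSum_norm_sq f).summable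
      (ε ^ 2 / (M + 1)) (by positivity)
    refine ⟨s, fun t ht => ?_⟩
    have h1 := hs t ht
    rw [Real.norm_of_nonneg (by positivity), lt_div_iff₀ (by positivity)] at h1
    refine lt_of_pow_lt_pow_left₀ 2 hε.le ((h t f).trans_lt (lt_of_le_of_lt ?_ h1))
    rw [mul_comm]
    gcongr
    linarith
  have hbound : ∀ f : HardyH2, ‖∑' k, f k • v k‖ ≤ √M * ‖f‖ := by
    intro f
    refine abs_le_of_sq_le_sq' ?_ (by positivity) |>.2
    rw [mul_pow, Real.sq_sqrt hM]
    refine le_of_tendsto_of_tendsto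
      ((continuous_norm.pow 2).continuousAt.tendsto.comp (hsum f).hasSum)
      ((hasSum_norm_sq f).mul_left M) (Eventually.of_forall fun s => ?_)
    simpa [Finset.mul_sum] using h s f
  refine ⟨LinearMap.mkContinuous
    { toFun := fun f => ∑' k, f k • v k
      map_add' := fun f g => ?_
      map_smul' := fun c f => ?_ } (√M) hbound, fun k => ?_⟩
  · rw [← (hsum f).tsum_add (hsum g)]
    simp [add_smul]
  · rw [RingHom.id_apply, ← (hsum f).tsum_const_smul c]
    simp [mul_smul]
  · change ∑' n, monomial k n • v n = v k
    rw [tsum_eq_single k]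
    · simp [monomial_apply]
    · intro n hn
      simp [monomial_apply, hn]

end HardyH2

/-! ### Disk algebra functions as elements of `H²` -/

/-- A function of the disk algebra belongs to `H²`, with a norm controlled by its boundary
values. -/
theorem DiffContOnCl.exists_hardyH2 {g : ℂ → ℂ} (hg : DiffContOnCl ℂ g (Metric.ball 0 1)) :
    ∃ u : HardyH2, (∀ z : ℂ, ‖z‖ < 1 → u.eval z = g z) ∧
      ‖u‖ ^ 2 ≤ (2 * Real.pi)⁻¹ *
        ∫ t in (0 : ℝ)..2 * Real.pi, ‖g (Complex.exp (t * Complex.I))‖ ^ 2 := by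
  have hpi : (0 : ℝ) < 2 * Real.pi := by positivity
  set b : ℝ → ℂ := fun t => g (Complex.exp (t * Complex.I)) with hb
  have hbc : Continuous b := by
    have h1 : ContinuousOn g (Metric.closedBall 0 1) := by
      simpa [closure_ball] using hg.continuousOn
    refine h1.comp_continuous (by fun_prop) fun t => ?_
    simp [Complex.norm_exp_ofReal_mul_I]
  have hL2 : MeasureTheory.MemLp b 2 (MeasureTheory.volume.restrict (Ioc 0 (2 * Real.pi))) := by
    obtain ⟨K, hK⟩ := (isCompact_Icc (a := (0 : ℝ)) (b := 2 * Real.pi)).exists_bound_of_continuousOn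
      hbc.continuousOn
    refine MeasureTheory.MemLp.of_bound hbc.aestronglyMeasurable K ?_
    filter_upwards [MeasureTheory.ae_restrict_mem measurableSet_Ioc] with t ht
    exact hK t ⟨ht.1.le, ht.2⟩
  have hpars := hasSum_sq_fourierCoeffOn hpi hL2
  set a : ℕ → ℂ := fun n => fourierCoeffOn hpi b n with ha
  have hsummable : Summable fun n : ℕ => ‖a n‖ ^ 2 :=
    hpars.summable.comp_injective Nat.cast_injective
  let u : HardyH2 := ⟨a, by
    refine memℓp_gen ?_
    simpa using hsummable⟩
  -- Cauchy's formula on the unit circle: the Taylor coefficients are the Fourier coefficients of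
  -- the boundary function.
  have hcoef : ∀ n : ℕ, (cauchyPowerSeries g 0 1).coeff n = a n := by
    intro n
    rw [FormalMultilinearSeries.coeff]
    change cauchyPowerSeries g 0 1 n (fun _ => 1) = _
    rw [cauchyPowerSeries_apply, ha]
    simp only [fourierCoeffOn_eq_integral, circleIntegral]
    rw [← intervalIntegral.integral_smul, ← intervalIntegral.integral_smul]
    refine intervalIntegral.integral_congr fun t _ => ?_
    simp only [circleMap_zero, deriv_circleMap, hb, fourier_coe_apply, smul_eq_mul,
      Complex.real_smul]
    have hne : Complex.exp (t * Complex.I) ≠ 0 := Complex.exp_ne_zero _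
    have hI := Complex.I_ne_zero
    have hpi' : (Real.pi : ℂ) ≠ 0 := by exact_mod_cast Real.pi_ne_zero
    have hexp : Complex.exp (2 * Real.pi * Complex.I * ((-(n : ℤ) : ℤ) : ℂ) * t
        / ((2 * Real.pi - 0 : ℝ) : ℂ)) = (Complex.exp (t * Complex.I) ^ n)⁻¹ := by
      rw [← Complex.exp_nat_mul, ← Complex.exp_neg]
      congr 1
      push_cast
      field_simp
      ring
    rw [hexp]
    generalize Complex.exp (t * Complex.I) = w at hne ⊢
    push_cast
    have hwn : w ^ n ≠ 0 := pow_ne_zero n hne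
    simp only [sub_zero, one_div, inv_pow]
    field_simp
  refine ⟨u, fun z hz => ?_, ?_⟩
  · have hps := hg.hasFPowerSeriesOnBall (R := 1) one_pos
    have h1 := hps.hasSum (y := z) (by simpa [enorm_eq_nnnorm, ← NNReal.coe_lt_coe] using hz)
    simp only [zero_add] at h1
    refine (HardyH2.hasSum_eval u hz).unique ?_
    refine (funext fun n => ?_ : (fun n => u n * z ^ n) = _) ▸ h1
    rw [FormalMultilinearSeries.apply_eq_pow_smul_coeff, smul_eq_mul, mul_comm, NNReal.coe_one,
      hcoef]
  · have h1 : ‖u‖ ^ 2 = ∑' n : ℕ, ‖a n‖ ^ 2 := (HardyH2.hasSum_norm_sq u).tsum_eq.symm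
    rw [h1]
    have h2 := hpars.tsum_eq
    rw [sub_zero, smul_eq_mul] at h2
    rw [← h2]
    -- The negative frequencies are simply dropped from Parseval's sum; their vanishing is not
    -- needed for an upper bound.
    exact tsum_comp_le_tsum_of_inj hpars.summable (fun _ => by positivity) Nat.cast_injective

/-! ### The shift -/

namespace HardyH2

theorem orthonormal_monomial_succ : Orthonormal ℂ fun k => monomial (k + 1) := by
  rw [orthonormal_iff_ite]
  intro i j
  rw [monomial, lp.inner_single_left]
  simp [monomial_apply]

/-- Multiplication by `z` on `H²`. -/
def shift : HardyH2 →L[ℂ] HardyH2 :=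
  orthonormal_monomial_succ.orthogonalFamily.linearIsometry.toContinuousLinearMap

theorem norm_shift (f : HardyH2) : ‖shift f‖ = ‖f‖ :=
  orthonormal_monomial_succ.orthogonalFamily.linearIsometry.norm_map f

theorem shift_monomial (k : ℕ) : shift (monomial k) = monomial (k + 1) := by
  have := orthonormal_monomial_succ.orthogonalFamily.linearIsometry_apply_single (i := k) (1 : ℂ)
  exact this.trans (by simp)

theorem eval_shift (f : HardyH2) {z : ℂ} (hz : ‖z‖ < 1) : (shift f).eval z = z * f.eval z := by
  have : evalCLM hz ∘L shift = z • evalCLM hz := by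
    refine clm_ext fun k => ?_
    simp [evalCLM_apply, shift_monomial, eval_monomial, pow_succ']
  exact congrArg (fun L => L f) this

theorem star_shift_mul_shift : star shift * shift = 1 :=
  (ContinuousLinearMap.norm_map_iff_adjoint_comp_self shift).1 norm_shift

theorem norm_shift_le : ‖shift‖ ≤ 1 :=
  shift.opNorm_le_bound zero_le_one fun f => by rw [norm_shift, one_mul]

/-- `S* (1 - S S*) = 0`, so every vector in the range is orthogonal to all `z^(k+1)`, hence is
constant. -/
theorem rank_one_sub_shift_mul_star_le :
    LinearMap.rank ((1 - shift * star shift : HardyH2 →L[ℂ] HardyH2) : HardyH2 →ₗ[ℂ] HardyH2)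
      ≤ 1 := by
  have hrange : LinearMap.range
      ((1 - shift * star shift : HardyH2 →L[ℂ] HardyH2) : HardyH2 →ₗ[ℂ] HardyH2) ≤
      Submodule.span ℂ {monomial 0} := by
    rintro _ ⟨x, rfl⟩
    set y : HardyH2 := (1 - shift * star shift) x with hy
    have hy0 : star shift y = 0 := by
      have : star shift * (1 - shift * star shift) = 0 := by
        rw [mul_sub, ← mul_assoc, star_shift_mul_shift]
        simp
      exact congrArg (fun L => L x) this
    have hcoord : ∀ k, y (k + 1) = 0 := by
      intro k
      have h1 : inner ℂ (monomial (k + 1)) y = y (k + 1) := by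
        rw [monomial, lp.inner_single_left]
        simp
      rw [← h1, ← shift_monomial, ← ContinuousLinearMap.adjoint_inner_right,
        ← ContinuousLinearMap.star_eq_adjoint, hy0, inner_zero_right]
    refine Submodule.mem_span_singleton.2 ⟨y 0, ?_⟩
    change _ = y
    ext n
    rcases n with _ | n
    · simp [monomial_apply]
    · simp [monomial_apply, hcoord]
  calc _ ≤ Module.rank ℂ (Submodule.span ℂ {monomial 0}) := Submodule.rank_mono hrange
    _ ≤ Cardinal.mk ({monomial 0} : Set HardyH2) := rank_span_le _
    _ = 1 := Cardinal.mk_singleton _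

end HardyH2

/-! ### Blaschke factors as multipliers of finite defect -/

/-- Multiplication by `b` is a bounded operator `W` on `H²` for which `1 - W W'` has rank at most
`m` for some contraction `W'`. -/
def IsMultiplierOfDefect (b : ℂ → ℂ) (m : ℕ) : Prop :=
  ∃ W W' : HardyH2 →L[ℂ] HardyH2, (∀ (f : HardyH2) (z : ℂ), ‖z‖ < 1 →
    (W f).eval z = b z * f.eval z) ∧ ‖W'‖ ≤ 1 ∧
    LinearMap.rank ((1 - W * W' : HardyH2 →L[ℂ] HardyH2) : HardyH2 →ₗ[ℂ] HardyH2) ≤ m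

namespace IsMultiplierOfDefect

theorem one : IsMultiplierOfDefect (fun _ => 1) 0 :=
  ⟨1, 1, fun f z _ => by simp, ContinuousLinearMap.norm_id_le, by simp⟩

/-- Defects add because `1 - W₁W₂W₂'W₁' = (1 - W₁W₁') + W₁(1 - W₂W₂')W₁'`. -/
theorem mul {b₁ b₂ : ℂ → ℂ} {m₁ m₂ : ℕ} (h₁ : IsMultiplierOfDefect b₁ m₁)
    (h₂ : IsMultiplierOfDefect b₂ m₂) :
    IsMultiplierOfDefect (fun z => b₁ z * b₂ z) (m₁ + m₂) := by
  obtain ⟨W₁, W₁', he₁, hn₁, hr₁⟩ := h₁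
  obtain ⟨W₂, W₂', he₂, hn₂, hr₂⟩ := h₂
  refine ⟨W₁ * W₂, W₂' * W₁', fun f z hz => ?_, ?_, ?_⟩
  · rw [mul_apply_eq_comp, he₁ _ _ hz, he₂ _ _ hz, mul_assoc]
  · calc ‖W₂' * W₁'‖ ≤ ‖W₂'‖ * ‖W₁'‖ := norm_mul_le _ _
      _ ≤ 1 := mul_le_one₀ hn₂ (norm_nonneg _) hn₁
  · have : (1 - W₁ * W₂ * (W₂' * W₁')) =
        (1 - W₁ * W₁') + W₁ * ((1 - W₂ * W₂') * W₁') := by noncomm_ring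
    rw [this, ContinuousLinearMap.toLinearMap_add]
    refine (LinearMap.rank_add_le _ _).trans ?_
    push_cast
    refine add_le_add hr₁ (le_trans ?_ hr₂)
    exact (LinearMap.rank_comp_le_right _ _).trans (LinearMap.rank_comp_le_left _ _)

theorem pow {b : ℂ → ℂ} {m : ℕ} (h : IsMultiplierOfDefect b m) (d : ℕ) :
    IsMultiplierOfDefect (fun z => b z ^ d) (d * m) := by
  induction d with
  | zero => simpa using one
  | succ d ih =>
    have := ih.mul h
    simpa only [pow_succ, Nat.succ_mul] using this

theorem prod {ι : Type*} (s : Finset ι) {b : ι → ℂ → ℂ} {m : ℕ}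
    (h : ∀ i ∈ s, IsMultiplierOfDefect (b i) m) :
    IsMultiplierOfDefect (fun z => ∏ i ∈ s, b i z) (s.card * m) := by
  classical
  induction s using Finset.induction_on with
  | empty => simpa using one
  | insert i s hi ih =>
    have := (h i (Finset.mem_insert_self i s)).mul
      (ih fun j hj => h j (Finset.mem_insert_of_mem hj))
    simp only [Finset.prod_insert hi, Finset.card_insert_of_notMem hi]
    rwa [Nat.succ_mul, add_comm]

end IsMultiplierOfDefect

/-- The Blaschke factor with zero `a`. -/
def blaschkeFactor (a z : ℂ) : ℂ := (z - a) / (1 - star a * z)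

/-- Functional calculus for the shift: take `W = (S - a)(1 - ā S)⁻¹` and `W' = W*`. With `u = 1 - ā
S`, `V = S - a`, `Q = u⁻¹`, the identity `u u* - V V* = (1 - |a|²)(1 - S S*)` gives `1 - W W* = (1 -
|a|²) Q (1 - S S*) Q*`. This has rank at most one, and it is positive, so `W*` is a contraction. -/
theorem isMultiplierOfDefect_blaschkeFactor {a : ℂ} (ha : ‖a‖ < 1) :
    IsMultiplierOfDefect (blaschkeFactor a) 1 := by
  set S := HardyH2.shift with hS
  have hlt : ‖star a • S‖ < 1 := by
    rw [norm_smul, norm_star]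
    calc ‖a‖ * ‖S‖ ≤ ‖a‖ * 1 := by gcongr; exact HardyH2.norm_shift_le
      _ < 1 := by simpa using ha
  obtain ⟨u, hu⟩ := isUnit_one_sub_of_norm_lt_one hlt
  set Q : HardyH2 →L[ℂ] HardyH2 := ↑u⁻¹ with hQ
  set V : HardyH2 →L[ℂ] HardyH2 := S - a • 1 with hV
  have hcomm : V * Q = Q * V := by
    have h1 : Commute V (u : HardyH2 →L[ℂ] HardyH2) := by
      rw [hu, hV]
      simp only [commute_iff_eq, sub_mul, mul_sub, mul_one, one_mul, smul_mul_assoc,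
        mul_smul_comm, smul_sub]
      module
    exact h1.units_inv_right
  have hQu : Q * (u : HardyH2 →L[ℂ] HardyH2) = 1 := u.inv_mul
  have huQ : (u : HardyH2 →L[ℂ] HardyH2) * Q = 1 := u.mul_inv
  have hdefect : 1 - V * Q * star (V * Q) =
      ((1 - ‖a‖ ^ 2 : ℝ) : ℂ) • (Q * ((1 - S * star S) * star Q)) := by
    have h1 : (1 : HardyH2 →L[ℂ] HardyH2) =
        Q * ((u : HardyH2 →L[ℂ] HardyH2) * star (u : HardyH2 →L[ℂ] HardyH2)) * star Q := by
      calc (1 : HardyH2 →L[ℂ] HardyH2) = (Q * u) * star (Q * u) := by rw [hQu]; simp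
        _ = _ := by rw [star_mul]; noncomm_ring
    have h2 : (u : HardyH2 →L[ℂ] HardyH2) * star (u : HardyH2 →L[ℂ] HardyH2) - V * star V =
        ((1 - ‖a‖ ^ 2 : ℝ) : ℂ) • (1 - S * star S) := by
      have h3 : ((1 - ‖a‖ ^ 2 : ℝ) : ℂ) = 1 - a * star a := by
        rw [Complex.star_def, Complex.mul_conj, Complex.normSq_eq_norm_sq]
        push_cast
        ring
      rw [hu, hV, h3]
      simp only [star_sub, star_smul, star_one, star_star, sub_mul, mul_sub, mul_one, one_mul,
        smul_mul_assoc, mul_smul_comm, smul_sub]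
      module
    rw [hcomm, star_mul]
    calc 1 - Q * V * (star V * star Q)
        = Q * ((u : HardyH2 →L[ℂ] HardyH2) * star (u : HardyH2 →L[ℂ] HardyH2)) * star Q -
          Q * V * (star V * star Q) := by rw [← h1]
      _ = Q * (((u : HardyH2 →L[ℂ] HardyH2) * star (u : HardyH2 →L[ℂ] HardyH2) - V * star V) *
          star Q) := by noncomm_ring
      _ = _ := by rw [h2, smul_mul_assoc, mul_smul_comm]
  have ha2 : 0 ≤ 1 - ‖a‖ ^ 2 := by nlinarith [norm_nonneg a]
  refine ⟨V * Q, star (V * Q), fun f z hz => ?_, ?_, ?_⟩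
  · have hf : f.eval z = (1 - star a * z) * (Q f).eval z := by
      have h1 : f = (1 - star a • S) (Q f) := by
        rw [← hu, ← mul_apply_eq_comp, huQ, one_apply_eq_self]
      have h2 := congrArg (HardyH2.evalCLM hz) h1
      simp only [sub_apply, one_apply_eq_self,
        smul_apply, map_sub, map_smul, HardyH2.evalCLM_apply, hS,
        HardyH2.eval_shift _ hz] at h2
      rw [h2, smul_eq_mul]
      ring
    have hW : ((V * Q) f).eval z = (z - a) * (Q f).eval z := by
      have h2 : HardyH2.evalCLM hz ((V * Q) f) = HardyH2.evalCLM hz (S (Q f) - a • Q f) := rfl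
      rw [map_sub, map_smul, HardyH2.evalCLM_apply, HardyH2.evalCLM_apply, HardyH2.evalCLM_apply,
        hS, HardyH2.eval_shift _ hz] at h2
      rw [h2, smul_eq_mul]
      ring
    have hne : 1 - star a * z ≠ 0 := by
      intro h0
      have : ‖star a * z‖ = 1 := by rw [← sub_eq_zero.1 h0, norm_one]
      rw [norm_mul, norm_star] at this
      nlinarith [norm_nonneg a, norm_nonneg z]
    rw [hW, hf, blaschkeFactor, ← mul_assoc, div_mul_cancel₀ _ hne]
  · refine ContinuousLinearMap.opNorm_le_bound _ zero_le_one fun x => ?_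
    rw [one_mul]
    refine abs_le_of_sq_le_sq' ?_ (norm_nonneg _) |>.2
    have h1 : ‖x‖ ^ 2 - ‖star (V * Q) x‖ ^ 2 =
        (1 - ‖a‖ ^ 2) * (‖star Q x‖ ^ 2 - ‖star S (star Q x)‖ ^ 2) := by
      have h2 := congrArg (fun L : HardyH2 →L[ℂ] HardyH2 => inner ℂ x (L x)) hdefect
      have key : ∀ (A : HardyH2 →L[ℂ] HardyH2) (x y : HardyH2),
          inner ℂ x (A y) = inner ℂ (star A x) y := fun A x y => by
        rw [ContinuousLinearMap.star_eq_adjoint, ContinuousLinearMap.adjoint_inner_left]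
      simp only [sub_apply, one_apply_eq_self, smul_apply, inner_sub_right,
        inner_smul_right] at h2
      rw [mul_apply_eq_comp (V * Q), key (V * Q), mul_apply_eq_comp Q,
        key Q, mul_apply_eq_comp (1 - S * star S), sub_apply,
        one_apply_eq_self, inner_sub_right, mul_apply_eq_comp S, key S] at h2
      simp only [inner_self_eq_norm_sq_to_K] at h2
      norm_cast at h2
      exact Complex.ofReal_injective (h2.trans (Complex.ofReal_mul _ _).symm)
    have h3 : ‖star S (star Q x)‖ ≤ ‖star Q x‖ := by
      have := (star S).le_opNorm (star Q x)
      rw [ContinuousLinearMap.star_eq_adjoint, LinearIsometryEquiv.norm_map] at this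
      exact this.trans (mul_le_of_le_one_left (norm_nonneg _) HardyH2.norm_shift_le)
    have h4 : ‖star S (star Q x)‖ ^ 2 ≤ ‖star Q x‖ ^ 2 := by gcongr
    nlinarith [mul_nonneg ha2 (sub_nonneg.2 h4)]
  · rw [hdefect]
    have h1 : ((((1 - ‖a‖ ^ 2 : ℝ) : ℂ) • (Q * ((1 - S * star S) * star Q)) :
        HardyH2 →L[ℂ] HardyH2) : HardyH2 →ₗ[ℂ] HardyH2) =
        ((((1 - ‖a‖ ^ 2 : ℝ) : ℂ) • Q : HardyH2 →L[ℂ] HardyH2) : HardyH2 →ₗ[ℂ] HardyH2) ∘ₗ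
          ((1 - S * star S : HardyH2 →L[ℂ] HardyH2) : HardyH2 →ₗ[ℂ] HardyH2) ∘ₗ
            ((star Q : HardyH2 →L[ℂ] HardyH2) : HardyH2 →ₗ[ℂ] HardyH2) := rfl
    rw [h1, Nat.cast_one]
    exact ((LinearMap.rank_comp_le_right _ _).trans (LinearMap.rank_comp_le_left _ _)).trans
      HardyH2.rank_one_sub_shift_mul_star_le

/-! ### Approximation numbers -/

theorem approxNumber_le {E F : Type*} [NormedAddCommGroup E] [NormedSpace ℂ E]
    [NormedAddCommGroup F] [NormedSpace ℂ F] {n : ℕ} (T R : E →L[ℂ] F)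
    (hR : LinearMap.rank (R : E →ₗ[ℂ] F) < (n : Cardinal)) : approxNumber n T ≤ ‖T - R‖ :=
  csInf_le ⟨0, by rintro _ ⟨R, -, rfl⟩; exact norm_nonneg _⟩ ⟨R, hR, rfl⟩

theorem approxNumber_le_norm {E F : Type*} [NormedAddCommGroup E] [NormedSpace ℂ E]
    [NormedAddCommGroup F] [NormedSpace ℂ F] {n : ℕ} (hn : 1 ≤ n) (T : E →L[ℂ] F) :
    approxNumber n T ≤ ‖T‖ := by
  have := approxNumber_le (n := n) T 0 (by
    rw [ContinuousLinearMap.toLinearMap_zero, LinearMap.rank_zero]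
    exact_mod_cast hn)
  simpa using this

/-- The competitor is `R = T (1 - W W')`: its rank is at most `m`, and `T - R = (T W) W'`. -/
theorem approxNumber_le_of_defect (T W W' : HardyH2 →L[ℂ] HardyH2) {m q : ℕ} (hW' : ‖W'‖ ≤ 1)
    (hr : LinearMap.rank ((1 - W * W' : HardyH2 →L[ℂ] HardyH2) : HardyH2 →ₗ[ℂ] HardyH2) ≤ m)
    (hmq : m < q) : approxNumber q T ≤ ‖T * W‖ := by
  refine (approxNumber_le T (T * (1 - W * W')) ?_).trans ?_
  · exact ((LinearMap.rank_comp_le_right _ _).trans hr).trans_lt (by exact_mod_cast hmq)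
  · have : T - T * (1 - W * W') = T * W * W' := by noncomm_ring
    rw [this]
    exact (norm_mul_le _ _).trans (mul_le_of_le_one_right (norm_nonneg _) hW')

/-! ### Hilbert's inequality by a Schur test -/

/-- Telescoping bound for the Schur test with weights `1/√(k+1)`. With `a = √k`, `b = √(k+1)`, `c =
√(j+1)`, the constant `8` is the product of the `2` in `1 ≤ 2b(b - a)` and the `4` in `(b + c)(a +
c) ≤ 4(j + k + 1)`. -/
theorem hilbert_kernel_le_sub (j k : ℕ) :
    √((j : ℝ) + 1) / (√((k : ℝ) + 1) * (j + k + 1)) ≤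
      8 * (√((k + 1 : ℕ) : ℝ) / (√((k + 1 : ℕ) : ℝ) + √((j : ℝ) + 1)) -
        √(k : ℝ) / (√(k : ℝ) + √((j : ℝ) + 1))) := by
  have hj : (0 : ℝ) ≤ j := Nat.cast_nonneg j
  have hk : (0 : ℝ) ≤ k := Nat.cast_nonneg k
  push_cast
  have ha2 := Real.sq_sqrt hk
  have hb2 := Real.sq_sqrt (by positivity : (0 : ℝ) ≤ k + 1)
  have hc2 := Real.sq_sqrt (by positivity : (0 : ℝ) ≤ j + 1)
  have ha : 0 ≤ √(k : ℝ) := Real.sqrt_nonneg _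
  have hb : 0 < √((k : ℝ) + 1) := Real.sqrt_pos.2 (by positivity)
  have hc : 0 < √((j : ℝ) + 1) := Real.sqrt_pos.2 (by positivity)
  have hab : √(k : ℝ) ≤ √((k : ℝ) + 1) := Real.sqrt_le_sqrt (by linarith)
  set a := √(k : ℝ)
  set b := √((k : ℝ) + 1)
  set c := √((j : ℝ) + 1)
  have h1 : b / (b + c) - a / (a + c) = c * (b - a) / ((b + c) * (a + c)) := by
    field_simp
    ring
  have h2 : 1 ≤ 2 * (b * (b - a)) := by nlinarith [sq_nonneg (b - a)]
  have h3 : (b + c) * (a + c) ≤ 4 * (j + k + 1) := by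
    nlinarith [sq_nonneg (b - c), mul_le_mul_of_nonneg_left hab (add_pos hb hc).le]
  rw [h1, ← mul_div_assoc, div_le_div_iff₀ (by positivity) (by positivity)]
  have h4 : (b + c) * (a + c) ≤ 8 * (b * (b - a)) * (j + k + 1) := by
    nlinarith [mul_le_mul_of_nonneg_right h2 (by positivity : (0 : ℝ) ≤ j + k + 1)]
  calc c * ((b + c) * (a + c)) ≤ c * (8 * (b * (b - a)) * (j + k + 1)) := by gcongr
    _ = _ := by ring

theorem sum_hilbert_kernel_le (j : ℕ) (s : Finset ℕ) :
    ∑ k ∈ s, √((j : ℝ) + 1) / (√((k : ℝ) + 1) * (j + k + 1)) ≤ 8 := by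
  obtain ⟨n, hn⟩ := s.exists_nat_subset_range
  calc _ ≤ ∑ k ∈ Finset.range n, √((j : ℝ) + 1) / (√((k : ℝ) + 1) * (j + k + 1)) :=
        Finset.sum_le_sum_of_subset_of_nonneg hn fun _ _ _ => by positivity
    _ ≤ ∑ k ∈ Finset.range n, 8 * (√((k + 1 : ℕ) : ℝ) / (√((k + 1 : ℕ) : ℝ) + √((j : ℝ) + 1)) -
        √(k : ℝ) / (√(k : ℝ) + √((j : ℝ) + 1))) :=
        Finset.sum_le_sum fun k _ => hilbert_kernel_le_sub j k
    _ = 8 * (√(n : ℝ) / (√(n : ℝ) + √((j : ℝ) + 1))) := by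
        rw [← Finset.mul_sum, Finset.sum_range_sub
          (fun k : ℕ => √(k : ℝ) / (√(k : ℝ) + √((j : ℝ) + 1)))]
        simp
    _ ≤ 8 := by
        have : √(n : ℝ) / (√(n : ℝ) + √((j : ℝ) + 1)) ≤ 1 := by
          refine div_le_one_of_le₀ ?_ (by positivity)
          linarith [Real.sqrt_nonneg ((j : ℝ) + 1)]
        linarith

/-- Hilbert's inequality, with a constant that is not optimal. -/
theorem hilbert_inequality (s : Finset ℕ) (x : ℕ → ℝ) :
    ∑ j ∈ s, ∑ k ∈ s, x j * x k / (j + k + 1) ≤ 8 * ∑ k ∈ s, x k ^ 2 := by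
  set p : ℕ → ℕ → ℝ := fun j k => √((j : ℝ) + 1) / (√((k : ℝ) + 1) * (j + k + 1)) with hp
  -- Weighted AM-GM: the difference of the two sides is a square over a positive denominator.
  have hterm : ∀ j k : ℕ, x j * x k / (j + k + 1) ≤
      (x j ^ 2 * p j k + x k ^ 2 * p k j) / 2 := by
    intro j k
    have hc : 0 < √((j : ℝ) + 1) := Real.sqrt_pos.2 (by positivity)
    have hb : 0 < √((k : ℝ) + 1) := Real.sqrt_pos.2 (by positivity)
    have hd : (0 : ℝ) < j + k + 1 := by positivity
    have hcomm : (k : ℝ) + j + 1 = j + k + 1 := by ring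
    simp only [hp, hcomm]
    have : (x j ^ 2 * (√((j : ℝ) + 1) / (√((k : ℝ) + 1) * (j + k + 1))) +
        x k ^ 2 * (√((k : ℝ) + 1) / (√((j : ℝ) + 1) * (j + k + 1)))) / 2 -
        x j * x k / (j + k + 1) =
        (x j * √((j : ℝ) + 1) - x k * √((k : ℝ) + 1)) ^ 2 /
          (2 * (√((k : ℝ) + 1) * √((j : ℝ) + 1) * (j + k + 1))) := by
      field_simp
      ring
    rw [← sub_nonneg, this]
    positivity
  calc ∑ j ∈ s, ∑ k ∈ s, x j * x k / (j + k + 1)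
      ≤ ∑ j ∈ s, ∑ k ∈ s, (x j ^ 2 * p j k + x k ^ 2 * p k j) / 2 :=
        Finset.sum_le_sum fun j _ => Finset.sum_le_sum fun k _ => hterm j k
    _ = ∑ j ∈ s, x j ^ 2 * ∑ k ∈ s, p j k := by
        simp only [add_div, Finset.sum_add_distrib]
        rw [Finset.sum_comm (f := fun j k => x k ^ 2 * p k j / 2), ← Finset.sum_add_distrib]
        refine Finset.sum_congr rfl fun j _ => ?_
        rw [← Finset.sum_add_distrib, Finset.mul_sum]
        exact Finset.sum_congr rfl fun k _ => by ring
    _ ≤ ∑ j ∈ s, x j ^ 2 * 8 := by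
        gcongr with j
        exact sum_hilbert_kernel_le j s
    _ = _ := by rw [← Finset.sum_mul, mul_comm]

theorem sum_range_succ_mul_two_pow_neg_le (n : ℕ) :
    ∑ i ∈ Finset.range n, ((i : ℝ) + 1) * (1 / 2) ^ i ≤ 4 := by
  have h : ∑ i ∈ Finset.range n, ((i : ℝ) + 1) * (1 / 2) ^ i =
      4 - (2 * n + 4) * (1 / 2) ^ n := by
    induction n with
    | zero => norm_num
    | succ n ih =>
      rw [Finset.sum_range_succ, ih, pow_succ]
      push_cast
      ring
  rw [h]
  have : (0 : ℝ) ≤ (2 * n + 4) * (1 / 2) ^ n := by positivity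
  linarith

/-! ### A radial Carleson embedding -/

section Carleson

open MeasureTheory

variable {X : Type*} [MeasurableSpace X] {μ : Measure X} {w ρ : X → ℝ} {ε : ℝ}

/-- The moments of a measure on `[0, 1]` are controlled by its mass near the point `1`. -/
theorem integral_one_sub_pow_mul_le (hw : Integrable w μ) (hw0 : ∀ x, 0 ≤ w x)
    (hρ : Measurable ρ) (hρ0 : ∀ x, 0 ≤ ρ x) (hρ1 : ∀ x, ρ x ≤ 1) (hε : 0 ≤ ε)
    (h : ∀ r > 0, ∫ x in {x | ρ x ≤ r}, w x ∂μ ≤ ε * r) (k : ℕ) :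
    ∫ x, (1 - ρ x) ^ k * w x ∂μ ≤ 12 * ε / (k + 1) := by
  have hm : (0 : ℝ) < k + 1 := by positivity
  -- On the shell `i ≤ (k+1) ρ < i + 1`, which lies in `A i`, one has `(1 - ρ)^k ≤ e · e⁻ⁱ ≤ 3 ·
  -- 2⁻ⁱ`. Since `ρ ≤ 1`, the indices `i ≤ k + 1` suffice. Then `12 = 3 · 4`, where `4` bounds `∑
  -- (i+1) 2⁻ⁱ`.
  set A : ℕ → Set X := fun i => {x | ρ x ≤ (i + 1) / (k + 1)} with hA
  have hAm : ∀ i, MeasurableSet (A i) := fun i => measurableSet_le hρ measurable_const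
  have hpt : ∀ x, (1 - ρ x) ^ k * w x ≤
      ∑ i ∈ Finset.range (k + 2), 3 * (1 / 2) ^ i * (A i).indicator w x := by
    intro x
    set i := ⌊(k + 1) * ρ x⌋₊ with hi
    have hnn : 0 ≤ (k + 1) * ρ x := mul_nonneg hm.le (hρ0 x)
    have hi1 : (i : ℝ) ≤ (k + 1) * ρ x := Nat.floor_le hnn
    have hi2 : (k + 1) * ρ x < i + 1 := Nat.lt_floor_add_one _
    have hik : i ∈ Finset.range (k + 2) := by
      have h1 : (i : ℝ) ≤ ((k + 1 : ℕ) : ℝ) := by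
        push_cast
        nlinarith [hρ1 x]
      have h2 : i ≤ k + 1 := by exact_mod_cast h1
      exact Finset.mem_range.2 (by omega)
    have hmem : x ∈ A i := by
      change ρ x ≤ _
      rw [le_div_iff₀ hm]
      linarith
    have hpow : (1 - ρ x) ^ k ≤ 3 * (1 / 2) ^ i := by
      have h1 : (1 - ρ x) ^ k ≤ Real.exp (-(k * ρ x)) := by
        rw [← mul_neg, Real.exp_nat_mul]
        refine pow_le_pow_left₀ (by linarith [hρ1 x]) ?_ k
        linarith [Real.add_one_le_exp (-ρ x)]
      have h2 : Real.exp (-(k * ρ x)) ≤ Real.exp 1 * Real.exp (-(i : ℝ)) := by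
        rw [← Real.exp_add]
        refine Real.exp_le_exp.2 ?_
        linarith [hρ1 x]
      have h3 : Real.exp (-(i : ℝ)) ≤ (1 / 2) ^ i := by
        rw [show -(i : ℝ) = i * (-1) by ring, Real.exp_nat_mul]
        refine pow_le_pow_left₀ (Real.exp_pos _).le ?_ i
        rw [Real.exp_neg, one_div]
        exact inv_anti₀ (by norm_num) (by linarith [Real.exp_one_gt_d9])
      calc _ ≤ _ := h1
        _ ≤ _ := h2
        _ ≤ 3 * (1 / 2) ^ i := by
          gcongr
          linarith [Real.exp_one_lt_d9]
    calc (1 - ρ x) ^ k * w x ≤ 3 * (1 / 2) ^ i * w x := by gcongr; exact hw0 x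
      _ = 3 * (1 / 2) ^ i * (A i).indicator w x := by rw [indicator_of_mem hmem]
      _ ≤ _ := Finset.single_le_sum
          (f := fun i => 3 * (1 / 2 : ℝ) ^ i * (A i).indicator w x)
          (fun j _ => mul_nonneg (by positivity) (indicator_nonneg (fun y _ => hw0 y) x)) hik
  have hint : ∀ i, Integrable (fun x => 3 * (1 / 2 : ℝ) ^ i * (A i).indicator w x) μ :=
    fun i => (hw.indicator (hAm i)).const_mul _
  have hpow0 : ∀ x, 0 ≤ (1 - ρ x) ^ k := fun x => pow_nonneg (by linarith [hρ1 x]) k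
  calc ∫ x, (1 - ρ x) ^ k * w x ∂μ
      ≤ ∫ x, ∑ i ∈ Finset.range (k + 2), 3 * (1 / 2) ^ i * (A i).indicator w x ∂μ :=
        integral_mono_of_nonneg (Eventually.of_forall fun x => mul_nonneg (hpow0 x) (hw0 x))
          (integrable_finsetSum _ fun i _ => hint i) (Eventually.of_forall hpt)
    _ = ∑ i ∈ Finset.range (k + 2), 3 * (1 / 2) ^ i * ∫ x in A i, w x ∂μ := by
        rw [integral_finsetSum _ fun i _ => hint i]
        refine Finset.sum_congr rfl fun i _ => ?_
        rw [integral_const_mul, integral_indicator (hAm i)]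
    _ ≤ ∑ i ∈ Finset.range (k + 2), 3 * (1 / 2) ^ i * (ε * ((i + 1) / (k + 1))) := by
        gcongr with i
        exact h _ (by positivity)
    _ = 3 * ε / (k + 1) * ∑ i ∈ Finset.range (k + 2), ((i : ℝ) + 1) * (1 / 2) ^ i := by
        rw [Finset.mul_sum]
        exact Finset.sum_congr rfl fun i _ => by ring
    _ ≤ 3 * ε / (k + 1) * 4 := by
        gcongr
        exact sum_range_succ_mul_two_pow_neg_le _
    _ = _ := by ring

/-- Carleson's embedding theorem for measures that satisfy a radial Carleson condition. -/
theorem integral_norm_sq_sum_pow_mul_le {γ : X → ℂ} (hγ : Measurable γ) (hγ1 : ∀ x, ‖γ x‖ ≤ 1)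
    (hw : Integrable w μ) (hw0 : ∀ x, 0 ≤ w x) (hε : 0 ≤ ε)
    (h : ∀ r > 0, ∫ x in {x | 1 - ‖γ x‖ ≤ r}, w x ∂μ ≤ ε * r) (s : Finset ℕ) (c : ℕ → ℂ) :
    ∫ x, ‖∑ k ∈ s, c k * γ x ^ k‖ ^ 2 * w x ∂μ ≤ 96 * ε * ∑ k ∈ s, ‖c k‖ ^ 2 := by
  have hmom := integral_one_sub_pow_mul_le hw hw0 (ρ := fun x => 1 - ‖γ x‖)
    (measurable_const.sub hγ.norm) (fun x => by simpa using hγ1 x)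
    (fun x => by simp) hε h
  simp only [sub_sub_cancel] at hmom
  have hint : ∀ k, Integrable (fun x => ‖γ x‖ ^ k * w x) μ := fun k => by
    refine hw.bdd_mul (c := 1) (hγ.norm.pow_const k).aestronglyMeasurable
      (Eventually.of_forall fun x => ?_)
    rw [norm_pow, norm_norm]
    exact pow_le_one₀ (norm_nonneg _) (hγ1 x)
  have hint2 : ∀ j k, Integrable (fun x => ‖c j‖ * ‖c k‖ * (‖γ x‖ ^ (j + k) * w x)) μ :=
    fun j k => (hint (j + k)).const_mul _
  -- The argument of `γ` is discarded; only the radial moments remain, and these produce the Hilbert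
  -- kernel. The final constant is `96 = 12 · 8`.
  have hpt : ∀ x, ‖∑ k ∈ s, c k * γ x ^ k‖ ^ 2 * w x ≤
      ∑ j ∈ s, ∑ k ∈ s, ‖c j‖ * ‖c k‖ * (‖γ x‖ ^ (j + k) * w x) := by
    intro x
    have h1 : ‖∑ k ∈ s, c k * γ x ^ k‖ ≤ ∑ k ∈ s, ‖c k‖ * ‖γ x‖ ^ k := by
      refine (norm_sum_le _ _).trans (Finset.sum_le_sum fun k _ => ?_)
      rw [norm_mul, norm_pow]
    calc ‖∑ k ∈ s, c k * γ x ^ k‖ ^ 2 * w x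
        ≤ (∑ k ∈ s, ‖c k‖ * ‖γ x‖ ^ k) ^ 2 * w x := by
          gcongr
          exact hw0 x
      _ = _ := by
          rw [sq, Finset.sum_mul_sum, Finset.sum_mul]
          refine Finset.sum_congr rfl fun j _ => ?_
          rw [Finset.sum_mul]
          exact Finset.sum_congr rfl fun k _ => by ring
  calc ∫ x, ‖∑ k ∈ s, c k * γ x ^ k‖ ^ 2 * w x ∂μ
      ≤ ∫ x, ∑ j ∈ s, ∑ k ∈ s, ‖c j‖ * ‖c k‖ * (‖γ x‖ ^ (j + k) * w x) ∂μ :=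
        integral_mono_of_nonneg
          (Eventually.of_forall fun x => mul_nonneg (by positivity) (hw0 x))
          (integrable_finsetSum _ fun j _ => integrable_finsetSum _ fun k _ => hint2 j k)
          (Eventually.of_forall hpt)
    _ = ∑ j ∈ s, ∑ k ∈ s, ‖c j‖ * ‖c k‖ * ∫ x, ‖γ x‖ ^ (j + k) * w x ∂μ := by
        rw [integral_finsetSum _ fun j _ => integrable_finsetSum _ fun k _ => hint2 j k]
        refine Finset.sum_congr rfl fun j _ => ?_
        rw [integral_finsetSum _ fun k _ => hint2 j k]
        exact Finset.sum_congr rfl fun k _ => integral_const_mul _ _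
    _ ≤ ∑ j ∈ s, ∑ k ∈ s, ‖c j‖ * ‖c k‖ * (12 * ε / (j + k + 1)) := by
        gcongr with j _ k
        exact_mod_cast hmom (j + k)
    _ = 12 * ε * ∑ j ∈ s, ∑ k ∈ s, ‖c j‖ * ‖c k‖ / (j + k + 1) := by
        simp only [Finset.mul_sum]
        exact Finset.sum_congr rfl fun j _ => Finset.sum_congr rfl fun k _ => by ring
    _ ≤ 12 * ε * (8 * ∑ k ∈ s, ‖c k‖ ^ 2) := by
        gcongr
        exact hilbert_inequality s fun k => ‖c k‖
    _ = _ := by ring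

end Carleson

/-! ### Symbols and functions of the disk algebra -/

namespace IsDiskAlgebraSymbol

open MeasureTheory

variable {φ : ℂ → ℂ}

theorem diffContOnCl (hφ : IsDiskAlgebraSymbol φ) : DiffContOnCl ℂ φ (Metric.ball 0 1) :=
  ⟨hφ.differentiableOn, by simpa [closure_ball] using hφ.continuousOn⟩

theorem norm_lt_one (hφ : IsDiskAlgebraSymbol φ) {z : ℂ} (hz : ‖z‖ < 1) : ‖φ z‖ < 1 := by
  simpa using hφ.mapsTo (x := z) (by simpa using hz)

theorem norm_le_one (hφ : IsDiskAlgebraSymbol φ) {z : ℂ} (hz : ‖z‖ ≤ 1) : ‖φ z‖ ≤ 1 := by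
  have h := hφ.mapsTo.closure_of_continuousOn
    (by simpa [closure_ball] using hφ.continuousOn)
  rw [closure_ball (0 : ℂ) one_ne_zero] at h
  simpa using h (x := z) (by simpa using hz)

theorem continuous_boundaryCurve (hφ : IsDiskAlgebraSymbol φ) : Continuous (boundaryCurve φ) :=
  hφ.continuousOn.comp_continuous (by fun_prop) fun t => by
    simp [Complex.norm_exp_ofReal_mul_I]

theorem norm_boundaryCurve_le (hφ : IsDiskAlgebraSymbol φ) (t : ℝ) : ‖boundaryCurve φ t‖ ≤ 1 :=
  hφ.norm_le_one (by simp [Complex.norm_exp_ofReal_mul_I])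

end IsDiskAlgebraSymbol

theorem DiffContOnCl.pow_ball {f : ℂ → ℂ} (hf : DiffContOnCl ℂ f (Metric.ball 0 1)) (k : ℕ) :
    DiffContOnCl ℂ (fun z => f z ^ k) (Metric.ball 0 1) :=
  ⟨hf.1.pow k, hf.2.pow k⟩

theorem DiffContOnCl.mul_ball {f g : ℂ → ℂ} (hf : DiffContOnCl ℂ f (Metric.ball 0 1))
    (hg : DiffContOnCl ℂ g (Metric.ball 0 1)) :
    DiffContOnCl ℂ (fun z => f z * g z) (Metric.ball 0 1) :=
  ⟨hf.1.mul hg.1, hf.2.mul hg.2⟩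

theorem DiffContOnCl.continuous_circle {f : ℂ → ℂ} (hf : DiffContOnCl ℂ f (Metric.ball 0 1)) :
    Continuous fun t : ℝ => f (Complex.exp (t * Complex.I)) := by
  have h1 : ContinuousOn f (Metric.closedBall 0 1) := by
    simpa [closure_ball] using hf.continuousOn
  exact h1.comp_continuous (by fun_prop) fun t => by simp [Complex.norm_exp_ofReal_mul_I]

/-! ### Composition operators and the Carleson condition -/

section Composition

open MeasureTheory

variable {φ g : ℂ → ℂ} {ε : ℝ}

/-- The weight `|g|²` on the circle satisfies a Carleson condition, relative to the sets where the
curve `φ(e^{it})` is close to the circle, with constant `ε`. -/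
def IsRadialCarleson (φ g : ℂ → ℂ) (ε : ℝ) : Prop :=
  ∀ r > 0, ∫ t in {t | 1 - ‖boundaryCurve φ t‖ ≤ r}, ‖g (Complex.exp (t * Complex.I))‖ ^ 2
    ∂(volume.restrict (Ioc 0 (2 * Real.pi))) ≤ ε * r

/-- The norm of `u` is bounded by the boundary integral of `|g|² |∑ c_k γ^k|²`, to which the
embedding applies with weight `|g|²`. Bounding `(2π)⁻¹` by `1/6` turns `96` into `16`. -/
theorem IsRadialCarleson.norm_sq_le (hφ : IsDiskAlgebraSymbol φ)
    (hg : DiffContOnCl ℂ g (Metric.ball 0 1)) (hε : 0 ≤ ε) (h : IsRadialCarleson φ g ε)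
    (s : Finset ℕ) (c : ℕ → ℂ) (u : HardyH2)
    (hu : ∀ z : ℂ, ‖z‖ < 1 → u.eval z = g z * ∑ k ∈ s, c k * φ z ^ k) :
    ‖u‖ ^ 2 ≤ 16 * ε * ∑ k ∈ s, ‖c k‖ ^ 2 := by
  have hpi : (0 : ℝ) < 2 * Real.pi := by positivity
  have hF : DiffContOnCl ℂ (fun z => g z * ∑ k ∈ s, c k * φ z ^ k) (Metric.ball 0 1) := by
    refine hg.mul_ball ⟨?_, ?_⟩
    · exact DifferentiableOn.fun_sum fun k _ => (hφ.diffContOnCl.1.pow k).const_mul (c k)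
    · exact continuousOn_finsetSum _ fun k _ =>
        continuousOn_const.mul (hφ.diffContOnCl.2.pow k)
  obtain ⟨v, hv, hvn⟩ := hF.exists_hardyH2
  have huv : u = v := HardyH2.eval_injective fun z hz => (hu z hz).trans (hv z hz).symm
  have hw : Integrable (fun t : ℝ => ‖g (Complex.exp (t * Complex.I))‖ ^ 2)
      (volume.restrict (Ioc 0 (2 * Real.pi))) :=
    ((hg.continuous_circle.norm.pow 2).integrableOn_Icc (a := 0) (b := 2 * Real.pi)).mono_set
      Ioc_subset_Icc_self
  have key := integral_norm_sq_sum_pow_mul_le (hφ.continuous_boundaryCurve.measurable)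
    hφ.norm_boundaryCurve_le hw (fun t => by positivity) hε h s c
  rw [huv]
  have hint : ∫ t in (0 : ℝ)..2 * Real.pi, ‖g (Complex.exp (t * Complex.I)) *
      ∑ k ∈ s, c k * φ (Complex.exp (t * Complex.I)) ^ k‖ ^ 2 ≤
      96 * ε * ∑ k ∈ s, ‖c k‖ ^ 2 := by
    rw [intervalIntegral.integral_of_le hpi.le]
    refine le_trans (le_of_eq ?_) key
    refine integral_congr_ae (Eventually.of_forall fun t => ?_)
    simp only [norm_mul, mul_pow, boundaryCurve, mul_comm]
  have hS : 0 ≤ ε * ∑ k ∈ s, ‖c k‖ ^ 2 := by positivity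
  calc ‖v‖ ^ 2 ≤ _ := hvn
    _ ≤ (2 * Real.pi)⁻¹ * (96 * ε * ∑ k ∈ s, ‖c k‖ ^ 2) := by gcongr
    _ ≤ 6⁻¹ * (96 * ε * ∑ k ∈ s, ‖c k‖ ^ 2) := by
        gcongr
        linarith [Real.pi_gt_three]
    _ = _ := by ring

/-- The operator is defined by `z^k ↦ φ^k`. As point evaluations are continuous, `T f = f ∘ φ` need
only be checked on monomials. -/
theorem IsRadialCarleson.exists_isCompositionOperator (hφ : IsDiskAlgebraSymbol φ) (hε : 0 ≤ ε)
    (h : IsRadialCarleson φ (fun _ => 1) ε) : ∃ T, IsCompositionOperator φ T := by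
  choose v hv _ using fun k => (hφ.diffContOnCl.pow_ball k).exists_hardyH2
  obtain ⟨T, hT⟩ := HardyH2.exists_clm v (M := 16 * ε) (by positivity) fun s c => by
    refine h.norm_sq_le hφ diffContOnCl_const hε s c _ fun z hz => ?_
    rw [← HardyH2.evalCLM_apply hz, map_sum, one_mul]
    refine Finset.sum_congr rfl fun k _ => ?_
    rw [map_smul, HardyH2.evalCLM_apply, hv k z hz, smul_eq_mul]
  refine ⟨T, fun f z hz => ?_⟩
  have : HardyH2.evalCLM hz ∘L T = HardyH2.evalCLM (hφ.norm_lt_one hz) :=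
    HardyH2.clm_ext fun k => by
      rw [ContinuousLinearMap.comp_apply, hT, HardyH2.evalCLM_apply, HardyH2.evalCLM_apply,
        hv k z hz, HardyH2.eval_monomial]
  exact congrArg (fun L => L f) this

theorem IsCompositionOperator.norm_mul_le {T W : HardyH2 →L[ℂ] HardyH2} {b : ℂ → ℂ}
    (hT : IsCompositionOperator φ T) (hφ : IsDiskAlgebraSymbol φ)
    (hW : ∀ (f : HardyH2) (z : ℂ), ‖z‖ < 1 → (W f).eval z = b z * f.eval z)
    (hb : DiffContOnCl ℂ (fun z => b (φ z)) (Metric.ball 0 1)) (hε : 0 ≤ ε)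
    (h : IsRadialCarleson φ (fun z => b (φ z)) ε) : ‖T * W‖ ≤ √(16 * ε) := by
  refine HardyH2.norm_clm_le _ (by positivity) fun s c => ?_
  refine h.norm_sq_le hφ hb hε s c _ fun z hz => ?_
  rw [← HardyH2.evalCLM_apply hz, map_sum, Finset.mul_sum]
  refine Finset.sum_congr rfl fun k _ => ?_
  rw [map_smul, HardyH2.evalCLM_apply, mul_apply_eq_comp, hT _ z hz, hW _ _ (hφ.norm_lt_one hz),
    HardyH2.eval_monomial, smul_eq_mul]
  ring

theorem IsCompositionOperator.approxNumber_le {T : HardyH2 →L[ℂ] HardyH2} {b : ℂ → ℂ} {m q : ℕ}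
    (hT : IsCompositionOperator φ T) (hφ : IsDiskAlgebraSymbol φ) (hb : IsMultiplierOfDefect b m)
    (hbφ : DiffContOnCl ℂ (fun z => b (φ z)) (Metric.ball 0 1)) (hε : 0 ≤ ε)
    (h : IsRadialCarleson φ (fun z => b (φ z)) ε) (hmq : m < q) :
    approxNumber q T ≤ √(16 * ε) := by
  obtain ⟨W, W', hW, hW', hr⟩ := hb
  exact (approxNumber_le_of_defect T W W' hW' hr hmq).trans (hT.norm_mul_le hφ hW hbφ hε h)

end Composition

/-! ### Moduli of continuity and their inverses -/

namespace IsModulusOfContinuity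

variable {A : ℝ} {ω : ℝ → ℝ}

theorem exists_eq (hω : IsModulusOfContinuity A ω) {y : ℝ} (hy0 : 0 ≤ y) (hy : y ≤ ω A) :
    ∃ x ∈ Icc 0 A, ω x = y :=
  intermediate_value_Icc hω.pos.le hω.continuousOn ⟨by rwa [hω.map_zero], hy⟩

theorem inv_mem (hω : IsModulusOfContinuity A ω) {y : ℝ} (hy0 : 0 ≤ y) (hy : y ≤ ω A) :
    modulusInv A ω y ∈ Icc 0 A :=
  Function.invFunOn_mem (hω.exists_eq hy0 hy)

theorem map_inv (hω : IsModulusOfContinuity A ω) {y : ℝ} (hy0 : 0 ≤ y) (hy : y ≤ ω A) :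
    ω (modulusInv A ω y) = y :=
  Function.invFunOn_eq (hω.exists_eq hy0 hy)

theorem map_pos (hω : IsModulusOfContinuity A ω) {x : ℝ} (hx0 : 0 < x) (hx : x ≤ A) :
    0 < ω x := by
  rw [← hω.map_zero]
  exact hω.strictMonoOn ⟨le_rfl, hω.pos.le⟩ ⟨hx0.le, hx⟩ hx0

theorem map_nonneg (hω : IsModulusOfContinuity A ω) {x : ℝ} (hx0 : 0 ≤ x) (hx : x ≤ A) :
    0 ≤ ω x := by
  rw [← hω.map_zero]
  exact hω.strictMonoOn.monotoneOn ⟨le_rfl, hω.pos.le⟩ ⟨hx0, hx⟩ hx0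

theorem le_inv (hω : IsModulusOfContinuity A ω) {x y : ℝ} (hx : x ∈ Icc 0 A) (hxy : ω x ≤ y)
    (hy : y ≤ ω A) : x ≤ modulusInv A ω y := by
  have hy0 : 0 ≤ y := (hω.map_nonneg hx.1 hx.2).trans hxy
  rw [← hω.map_inv hy0 hy] at hxy
  exact (hω.strictMonoOn.le_iff_le hx (hω.inv_mem hy0 hy)).1 hxy

theorem inv_le (hω : IsModulusOfContinuity A ω) {x y : ℝ} (hx : x ∈ Icc 0 A) (hy0 : 0 ≤ y)
    (hxy : y ≤ ω x) : modulusInv A ω y ≤ x := by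
  have hy : y ≤ ω A :=
    hxy.trans (hω.strictMonoOn.monotoneOn hx ⟨hω.pos.le, le_rfl⟩ hx.2)
  rw [← hω.map_inv hy0 hy] at hxy
  exact (hω.strictMonoOn.le_iff_le (hω.inv_mem hy0 hy) hx).1 hxy

theorem inv_map (hω : IsModulusOfContinuity A ω) {x : ℝ} (hx : x ∈ Icc 0 A) :
    modulusInv A ω (ω x) = x :=
  (hω.inv_le hx (hω.map_nonneg hx.1 hx.2) le_rfl).antisymm
    (hω.le_inv hx le_rfl (hω.strictMonoOn.monotoneOn hx ⟨hω.pos.le, le_rfl⟩ hx.2))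

theorem inv_pos (hω : IsModulusOfContinuity A ω) {y : ℝ} (hy0 : 0 < y) (hy : y ≤ ω A) :
    0 < modulusInv A ω y := by
  refine lt_of_le_of_ne (hω.inv_mem hy0.le hy).1 fun h => ?_
  have := hω.map_inv hy0.le hy
  rw [← h, hω.map_zero] at this
  exact hy0.ne this

theorem map_nat_mul_le (hω : IsModulusOfContinuity A ω) {x : ℝ} (hx : 0 ≤ x) (n : ℕ)
    (hn : n * x ≤ A) : ω (n * x) ≤ n * ω x := by
  induction n with
  | zero => simp [hω.map_zero]
  | succ n ih =>
    push_cast at hn ⊢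
    rw [add_mul, one_mul] at hn ⊢
    have h1 := hω.subadditive (n * x) x (by positivity) hx hn
    have h2 := ih (by linarith)
    linarith

/-- `ω⁻¹(y) / y` is increasing, up to a factor `2`. -/
theorem inv_mul_le (hω : IsModulusOfContinuity A ω) {y₁ y₂ : ℝ} (hy₁ : 0 < y₁) (hy : y₁ ≤ y₂)
    (hy₂ : y₂ ≤ ω A) : modulusInv A ω y₁ * y₂ ≤ 2 * y₁ * modulusInv A ω y₂ := by
  set x₁ := modulusInv A ω y₁ with hx₁
  set x₂ := modulusInv A ω y₂ with hx₂
  have hy₂0 : 0 < y₂ := hy₁.trans_le hy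
  have hm₁ : x₁ ∈ Icc 0 A := hω.inv_mem hy₁.le (hy.trans hy₂)
  have hm₂ : x₂ ∈ Icc 0 A := hω.inv_mem hy₂0.le hy₂
  -- Sub-additivity gives `n x₁ ≤ x₂`: otherwise `y₂ = ω x₂ ≤ n ω (x₂ / n) < n y₁ ≤ y₂`. The factor
  -- `2` comes from `y₂ < (n + 1) y₁ ≤ 2 n y₁`.
  set n := ⌊y₂ / y₁⌋₊ with hn
  have hn1 : 1 ≤ n := Nat.le_floor (by rwa [Nat.cast_one, one_le_div hy₁])
  have hn1' : (1 : ℝ) ≤ n := by exact_mod_cast hn1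
  have hn0 : (0 : ℝ) < n := by linarith
  have hny : n * y₁ ≤ y₂ := (le_div_iff₀ hy₁).1 (Nat.floor_le (by positivity))
  have hny' : y₂ < (n + 1) * y₁ := (div_lt_iff₀ hy₁).1 (Nat.lt_floor_add_one _)
  have hle : n * x₁ ≤ x₂ := by
    by_contra! hlt
    have hlt' : x₂ / n < x₁ := by rwa [div_lt_iff₀ hn0, mul_comm]
    have hmem : x₂ / n ∈ Icc 0 A :=
      ⟨div_nonneg hm₂.1 hn0.le, (div_le_self hm₂.1 hn1').trans hm₂.2⟩
    have h1 : ω (x₂ / n) < y₁ := by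
      rw [← hω.map_inv hy₁.le (hy.trans hy₂)]
      exact hω.strictMonoOn hmem hm₁ hlt'
    have h2 : (n : ℝ) * (x₂ / n) = x₂ := by field_simp
    have h3 := hω.map_nat_mul_le hmem.1 n (by rw [h2]; exact hm₂.2)
    rw [h2, hω.map_inv hy₂0.le hy₂] at h3
    nlinarith
  have h4 : y₂ ≤ 2 * n * y₁ := by nlinarith
  calc x₁ * y₂ ≤ x₁ * (2 * n * y₁) := by gcongr; exact hm₁.1
    _ = 2 * y₁ * (n * x₁) := by ring
    _ ≤ 2 * y₁ * x₂ := by gcongr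

end IsModulusOfContinuity

/-! ### Contact parameters and the time spent near the circle -/

theorem Set.finite_of_separated {S : Set ℝ} {a b r : ℝ} (hr : 0 < r) (hS : S ⊆ Icc a b)
    (hsep : ∀ s ∈ S, ∀ t ∈ S, |s - t| < r → s = t) : S.Finite := by
  refine Set.Finite.of_injOn (f := fun s : ℝ => ⌊s / r⌋) (t := Icc ⌊a / r⌋ ⌊b / r⌋) ?_ ?_
    (Set.finite_Icc _ _)
  · intro s hs
    exact ⟨Int.floor_le_floor (by gcongr; exact (hS hs).1),
      Int.floor_le_floor (by gcongr; exact (hS hs).2)⟩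
  · intro s hs t ht hst
    refine hsep s hs t ht ?_
    have := Int.abs_sub_lt_one_of_floor_eq_floor hst
    rwa [← sub_div, abs_div, abs_of_pos hr, div_lt_one hr] at this

/-- Two distinct parameters of the same contact point are at distance at least `r_j`, since the
lower bound `c ω(|t - s|)` is positive. Only those in `[-A, 2π + A]` can serve a `t` in `(0, 2π]`,
so finitely many suffice. Chaining the two regularity bounds gives `L = C / c`. -/
theorem IsGloballyRegular.exists_finset {φ : ℂ → ℂ} {p : ℕ} {ξ : Fin p → ℂ} {A : ℝ} {ω : ℝ → ℝ}
    (hω : IsModulusOfContinuity A ω) (h : IsGloballyRegular φ ξ A ω) :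
    ∃ S : Finset ℝ, ∃ C > 0, ∃ L > 0, ∀ t ∈ Ioc 0 (2 * Real.pi), ∃ j, ∃ s ∈ S,
      |t - s| ≤ A ∧ ω |t - s| ≤ L * (1 - ‖boundaryCurve φ t‖) ∧
      ‖boundaryCurve φ t - ξ j‖ ≤ C * (1 - ‖boundaryCurve φ t‖) := by
  obtain ⟨r, hr, hcov, C, hC, c, hc, hreg⟩ := h
  have hfin : (⋃ j, {s | boundaryCurve φ s = ξ j ∧ s ∈ Icc (-A) (2 * Real.pi + A)}).Finite := by
    refine Set.finite_iUnion fun j => Set.finite_of_separated (hr j).1 (fun s hs => hs.2) ?_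
    intro s hs t ht hst
    by_contra hne
    have h1 := (hreg j t s ht.1 hst.le).2
    have h2 := hω.map_pos (abs_pos.2 (sub_ne_zero.2 hne)) (hst.le.trans (hr j).2)
    rw [hs.1, ht.1, sub_self, norm_zero] at h1
    nlinarith
  refine ⟨hfin.toFinset, C, hC, C / c, by positivity, fun t ht => ?_⟩
  obtain ⟨j, s, hs, hts⟩ := hcov t
  have h1 := hreg j s t hs hts
  have hA := hts.trans (hr j).2
  refine ⟨j, s, ?_, hA, ?_, ?_⟩
  · rw [Set.Finite.mem_toFinset, mem_iUnion]
    refine ⟨j, hs, ?_, ?_⟩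
    · linarith [(abs_le.1 hA).2, ht.1]
    · linarith [(abs_le.1 hA).1, ht.2]
  · rw [div_mul_eq_mul_div, le_div_iff₀ hc, mul_comm]
    exact h1.2.trans h1.1
  · rw [← hs]
    exact h1.1

section Measure

open MeasureTheory

variable {γ : ℝ → ℂ} {A L : ℝ} {ω : ℝ → ℝ} {S : Finset ℝ}

/-- The set is covered by the intervals of radius `ω⁻¹(L r)` about the points of `S`. -/
theorem measureReal_one_sub_norm_le (hω : IsModulusOfContinuity A ω) (hL : 0 < L)
    (hS : ∀ t ∈ Ioc 0 (2 * Real.pi), ∃ s ∈ S, |t - s| ≤ A ∧ ω |t - s| ≤ L * (1 - ‖γ t‖))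
    (hγ : Measurable γ) {r : ℝ} (hr : 0 < r) (hrA : L * r ≤ ω A) :
    (volume.restrict (Ioc 0 (2 * Real.pi))).real {t | 1 - ‖γ t‖ ≤ r} ≤
      2 * S.card * modulusInv A ω (L * r) := by
  have hmeas : MeasurableSet {t | 1 - ‖γ t‖ ≤ r} :=
    measurableSet_le (measurable_const.sub hγ.norm) measurable_const
  rw [measureReal_restrict_apply hmeas]
  set η := modulusInv A ω (L * r) with hη
  have hη0 : 0 ≤ η := (hω.inv_mem (by positivity) hrA).1
  have hsub : {t | 1 - ‖γ t‖ ≤ r} ∩ Ioc 0 (2 * Real.pi) ⊆ ⋃ s ∈ S, Icc (s - η) (s + η) := by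
    rintro t ⟨ht, ht'⟩
    obtain ⟨s, hs, h1, h2⟩ := hS t ht'
    have h3 : |t - s| ≤ η :=
      hω.le_inv ⟨abs_nonneg _, h1⟩ (h2.trans (by gcongr; exact ht)) hrA
    rw [mem_iUnion₂]
    refine ⟨s, hs, ?_, ?_⟩
    · linarith [(abs_le.1 h3).1]
    · linarith [(abs_le.1 h3).2]
  have hfin : volume (⋃ s ∈ S, Icc (s - η) (s + η)) ≠ ⊤ := by
    refine ((measure_biUnion_finset_le S _).trans_lt ?_).ne
    exact ENNReal.sum_lt_top.2 fun s _ => measure_Icc_lt_top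
  calc volume.real ({t | 1 - ‖γ t‖ ≤ r} ∩ Ioc 0 (2 * Real.pi))
      ≤ volume.real (⋃ s ∈ S, Icc (s - η) (s + η)) := measureReal_mono hsub hfin
    _ ≤ ∑ s ∈ S, volume.real (Icc (s - η) (s + η)) := measureReal_biUnion_finset_le S _
    _ = ∑ _s ∈ S, 2 * η := by
        refine Finset.sum_congr rfl fun s _ => ?_
        rw [Real.volume_real_Icc_of_le (by linarith)]
        ring
    _ = _ := by rw [Finset.sum_const, nsmul_eq_mul]; ring

/-- For `L r ≤ ω A`, compare `ω⁻¹(y) / y` at `y = L r` and at `ω A`; for larger `r` the total mass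
`2π` is already `O(r)`. This is what makes `C_φ` bounded. -/
theorem exists_measureReal_one_sub_norm_le (hω : IsModulusOfContinuity A ω) (hL : 0 < L)
    (hS : ∀ t ∈ Ioc 0 (2 * Real.pi), ∃ s ∈ S, |t - s| ≤ A ∧ ω |t - s| ≤ L * (1 - ‖γ t‖))
    (hγ : Measurable γ) : ∃ M > 0, ∀ r > 0,
    (volume.restrict (Ioc 0 (2 * Real.pi))).real {t | 1 - ‖γ t‖ ≤ r} ≤ M * r := by
  have hA := hω.pos
  have hωA : 0 < ω A := hω.map_pos hA le_rfl
  refine ⟨(4 * S.card * A + 2 * Real.pi) * L / ω A, by positivity, fun r hr => ?_⟩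
  rcases le_or_gt (L * r) (ω A) with h | h
  · refine (measureReal_one_sub_norm_le hω hL hS hγ hr h).trans ?_
    have h1 := hω.inv_mul_le (mul_pos hL hr) h le_rfl
    rw [hω.inv_map ⟨hA.le, le_rfl⟩] at h1
    rw [div_mul_eq_mul_div, le_div_iff₀ hωA]
    calc 2 * S.card * modulusInv A ω (L * r) * ω A
        = 2 * S.card * (modulusInv A ω (L * r) * ω A) := by ring
      _ ≤ 2 * S.card * (2 * (L * r) * A) := by gcongr
      _ = 4 * S.card * A * L * r := by ring
      _ ≤ _ := by
        have : 0 ≤ 2 * Real.pi * L * r := by positivity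
        linarith
  · calc (volume.restrict (Ioc 0 (2 * Real.pi))).real {t | 1 - ‖γ t‖ ≤ r}
        ≤ (volume.restrict (Ioc 0 (2 * Real.pi))).real univ := measureReal_mono (subset_univ _)
      _ = 2 * Real.pi := by
        rw [measureReal_restrict_apply_univ, Real.volume_real_Ioc_of_le (by positivity), sub_zero]
      _ ≤ _ := by
        rw [div_mul_eq_mul_div, le_div_iff₀ hωA]
        have h1 : 2 * Real.pi * ω A ≤ 2 * Real.pi * (L * r) := by gcongr
        have h2 : 0 ≤ 4 * S.card * A * L * r := by positivity
        linarith

end Measure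

/-! ### Size of a Blaschke factor in a Stolz angle -/

theorem one_sub_star_mul_ne_zero {a z : ℂ} (ha : ‖a‖ < 1) (hz : ‖z‖ ≤ 1) :
    1 - star a * z ≠ 0 := by
  intro h0
  have : ‖star a * z‖ = 1 := by rw [← sub_eq_zero.1 h0, norm_one]
  rw [norm_mul, norm_star] at this
  nlinarith [norm_nonneg a, norm_nonneg z]

theorem norm_sq_one_sub_star_mul (a z : ℂ) :
    ‖1 - star a * z‖ ^ 2 = ‖z - a‖ ^ 2 + (1 - ‖a‖ ^ 2) * (1 - ‖z‖ ^ 2) := by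
  simp only [← Complex.normSq_eq_norm_sq, Complex.normSq_apply, Complex.star_def]
  simp
  ring

theorem norm_sq_blaschkeFactor_le {a z : ℂ} {τ : ℝ} (ha : ‖a‖ < 1) (hz : ‖z‖ ≤ 1)
    (h : τ * ‖1 - star a * z‖ ^ 2 ≤ (1 - ‖a‖ ^ 2) * (1 - ‖z‖ ^ 2)) :
    ‖blaschkeFactor a z‖ ^ 2 ≤ 1 - τ := by
  have hpos : 0 < ‖1 - star a * z‖ ^ 2 := by
    have := norm_pos_iff.2 (one_sub_star_mul_ne_zero ha hz)
    positivity
  rw [blaschkeFactor, norm_div, div_pow, div_le_iff₀ hpos]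
  linarith [norm_sq_one_sub_star_mul a z]

theorem norm_blaschkeFactor_le_one {a z : ℂ} (ha : ‖a‖ < 1) (hz : ‖z‖ ≤ 1) :
    ‖blaschkeFactor a z‖ ≤ 1 := by
  have h := norm_sq_blaschkeFactor_le (τ := 0) ha hz (by
    have := norm_nonneg a
    have := norm_nonneg z
    rw [zero_mul]
    exact mul_nonneg (by nlinarith) (by nlinarith))
  rw [sub_zero] at h
  exact (sq_le_one_iff₀ (norm_nonneg _)).1 h

/-- In a Stolz angle at `ξ`, the Blaschke factor with zero `(1 - δ) ξ` is small at the points whose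
distance to the circle is comparable to `δ`. -/
theorem norm_sq_blaschkeFactor_le_of_stolz {ξ z : ℂ} {C M δ : ℝ} (hξ : ‖ξ‖ = 1) (hz : ‖z‖ ≤ 1)
    (hC : 0 < C) (hzξ : ‖z - ξ‖ ≤ C * (1 - ‖z‖)) (hδ : 0 < δ) (hδ1 : δ < 1)
    (h1 : δ ≤ 1 - ‖z‖) (h2 : 1 - ‖z‖ ≤ M * δ) :
    ‖blaschkeFactor ((1 - δ : ℝ) * ξ) z‖ ^ 2 ≤ 1 - 1 / (C * M + 1) ^ 2 := by
  have hna : ‖((1 - δ : ℝ) : ℂ) * ξ‖ = 1 - δ := by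
    rw [norm_mul, hξ, mul_one, Complex.norm_real, Real.norm_of_nonneg (by linarith)]
  have hM : 0 < M := pos_of_mul_pos_left (hδ.trans_le (h1.trans h2)) hδ.le
  refine norm_sq_blaschkeFactor_le (by rw [hna]; linarith) hz ?_
  have hξξ : star ξ * ξ = 1 := by
    rw [Complex.star_def, mul_comm, Complex.mul_conj, Complex.normSq_eq_norm_sq, hξ]
    norm_num
  -- Hence `|1 - ā z| ≤ (C M + 1) δ` in the Stolz angle, while `(1 - |a|²)(1 - |z|²) ≥ δ²`.
  have heq : 1 - star (((1 - δ : ℝ) : ℂ) * ξ) * z = star ξ * (ξ - z) + δ * (star ξ * z) := by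
    rw [mul_sub, hξξ, star_mul', Complex.star_def, Complex.conj_ofReal]
    push_cast
    ring
  have hle : ‖1 - star (((1 - δ : ℝ) : ℂ) * ξ) * z‖ ≤ (C * M + 1) * δ := by
    rw [heq]
    calc _ ≤ ‖star ξ * (ξ - z)‖ + ‖(δ : ℂ) * (star ξ * z)‖ := norm_add_le _ _
      _ = ‖z - ξ‖ + δ * ‖z‖ := by
        rw [norm_mul, norm_star, hξ, one_mul, norm_mul, norm_mul, norm_star, hξ, one_mul,
          Complex.norm_real, Real.norm_of_nonneg hδ.le, norm_sub_rev]
      _ ≤ C * (M * δ) + δ * 1 := by gcongr; exact hzξ.trans (by gcongr)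
      _ = _ := by ring
  rw [hna]
  calc 1 / (C * M + 1) ^ 2 * ‖1 - star (((1 - δ : ℝ) : ℂ) * ξ) * z‖ ^ 2
      ≤ 1 / (C * M + 1) ^ 2 * ((C * M + 1) * δ) ^ 2 := by gcongr
    _ = δ * δ := by field_simp
    _ ≤ _ := by
      have := norm_nonneg z
      refine mul_le_mul ?_ ?_ hδ.le ?_ <;> nlinarith

theorem diffContOnCl_blaschkeFactor_comp {φ : ℂ → ℂ} (hφ : IsDiskAlgebraSymbol φ) {a : ℂ}
    (ha : ‖a‖ < 1) : DiffContOnCl ℂ (fun z => blaschkeFactor a (φ z)) (Metric.ball 0 1) := by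
  have h := hφ.diffContOnCl
  have hcl : ∀ z ∈ closure (Metric.ball (0 : ℂ) 1), ‖φ z‖ ≤ 1 := fun z hz => by
    rw [closure_ball (0 : ℂ) one_ne_zero] at hz
    exact hφ.norm_le_one (by simpa using hz)
  refine ⟨?_, ?_⟩
  · exact (h.1.sub_const a).fun_div ((differentiableOn_const 1).sub (h.1.const_mul (star a)))
      fun z hz => one_sub_star_mul_ne_zero ha (hcl z (subset_closure hz))
  · exact (h.2.sub continuousOn_const).div (continuousOn_const.sub (continuousOn_const.mul h.2))
      fun z hz => one_sub_star_mul_ne_zero ha (hcl z hz)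

/-! ### The Blaschke product with radial zeros -/

section BlaschkeProduct

variable {p : ℕ} {ξ : Fin p → ℂ} {δ : ℝ}

/-- The Blaschke product with zeros `(1 - δ 2⁻ⁿ) ξ_j`, `1 ≤ n ≤ N`, each of multiplicity `d`. -/
def radialBlaschke (ξ : Fin p → ℂ) (δ : ℝ) (N d : ℕ) (z : ℂ) : ℂ :=
  ∏ i ∈ Finset.univ ×ˢ Finset.Icc 1 N, blaschkeFactor ((1 - δ / 2 ^ i.2 : ℝ) * ξ i.1) z ^ d

theorem div_two_pow_le_half {n : ℕ} (hn : 1 ≤ n) (hδ1 : δ ≤ 1) :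
    δ / 2 ^ n ≤ 1 / 2 := by
  have h2 : (2 : ℝ) ^ 1 ≤ 2 ^ n := pow_le_pow_right₀ (by norm_num) hn
  rw [pow_one] at h2
  exact div_le_div₀ zero_le_one hδ1 two_pos h2

theorem norm_radial_zero_lt_one (hξ : ∀ j, ‖ξ j‖ = 1) (hδ : 0 < δ) (hδ1 : δ ≤ 1) {n : ℕ}
    (hn : 1 ≤ n) (j : Fin p) : ‖((1 - δ / 2 ^ n : ℝ) : ℂ) * ξ j‖ < 1 := by
  have h1 := div_two_pow_le_half hn hδ1
  have h2 : 0 < δ / 2 ^ n := by positivity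
  rw [norm_mul, hξ, mul_one, Complex.norm_real, Real.norm_of_nonneg (by linarith)]
  linarith

theorem isMultiplierOfDefect_radialBlaschke (hξ : ∀ j, ‖ξ j‖ = 1) (hδ : 0 < δ) (hδ1 : δ ≤ 1)
    (N d : ℕ) : IsMultiplierOfDefect (radialBlaschke ξ δ N d) (p * N * d) := by
  have := IsMultiplierOfDefect.prod (Finset.univ ×ˢ Finset.Icc 1 N)
    (b := fun i z => blaschkeFactor ((1 - δ / 2 ^ i.2 : ℝ) * ξ i.1) z ^ d) (m := d * 1)
    fun i hi => (isMultiplierOfDefect_blaschkeFactor (norm_radial_zero_lt_one hξ hδ hδ1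
      (Finset.mem_Icc.1 (Finset.mem_product.1 hi).2).1 i.1)).pow d
  rwa [Finset.card_product, Finset.card_univ, Fintype.card_fin, Nat.card_Icc, Nat.add_sub_cancel,
    mul_one] at this

theorem diffContOnCl_radialBlaschke_comp {φ : ℂ → ℂ} (hφ : IsDiskAlgebraSymbol φ)
    (hξ : ∀ j, ‖ξ j‖ = 1) (hδ : 0 < δ) (hδ1 : δ ≤ 1) (N d : ℕ) :
    DiffContOnCl ℂ (fun z => radialBlaschke ξ δ N d (φ z)) (Metric.ball 0 1) := by
  have h : ∀ i ∈ (Finset.univ : Finset (Fin p)) ×ˢ Finset.Icc 1 N,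
      DiffContOnCl ℂ (fun z => blaschkeFactor ((1 - δ / 2 ^ i.2 : ℝ) * ξ i.1) (φ z) ^ d)
        (Metric.ball 0 1) := fun i hi =>
    (diffContOnCl_blaschkeFactor_comp hφ (norm_radial_zero_lt_one hξ hδ hδ1
      (Finset.mem_Icc.1 (Finset.mem_product.1 hi).2).1 i.1)).pow_ball d
  exact ⟨DifferentiableOn.fun_finsetProd fun i hi => (h i hi).1,
    continuousOn_finsetProd _ fun i hi => (h i hi).2⟩

theorem norm_radialBlaschke_le_one (hξ : ∀ j, ‖ξ j‖ = 1) (hδ : 0 < δ) (hδ1 : δ ≤ 1) (N d : ℕ)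
    {z : ℂ} (hz : ‖z‖ ≤ 1) : ‖radialBlaschke ξ δ N d z‖ ≤ 1 := by
  rw [radialBlaschke, norm_prod]
  refine Finset.prod_le_one (fun _ _ => norm_nonneg _) fun i hi => ?_
  rw [norm_pow]
  exact pow_le_one₀ (norm_nonneg _) (norm_blaschkeFactor_le_one (norm_radial_zero_lt_one hξ hδ hδ1
    (Finset.mem_Icc.1 (Finset.mem_product.1 hi).2).1 i.1) hz)

/-- Take the least admissible `n`: for `n > 1` the previous scale exceeds `ρ`. The constant is `2 /
δ` rather than `2` so that `n = 1` covers all `ρ` up to `1`. -/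
theorem exists_dyadic_scale (hδ : 0 < δ) (hδ1 : δ ≤ 1) {N : ℕ} (hN : 1 ≤ N) {ρ : ℝ} (hρ : ρ ≤ 1)
    (hNρ : δ / 2 ^ N ≤ ρ) : ∃ n ∈ Finset.Icc 1 N, δ / 2 ^ n ≤ ρ ∧ ρ ≤ 2 / δ * (δ / 2 ^ n) := by
  classical
  have hex : ∃ n, 1 ≤ n ∧ δ / 2 ^ n ≤ ρ := ⟨N, hN, hNρ⟩
  obtain ⟨h1, h2⟩ := Nat.find_spec hex
  refine ⟨Nat.find hex, Finset.mem_Icc.2 ⟨h1, Nat.find_min' hex ⟨hN, hNρ⟩⟩, h2, ?_⟩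
  have hmin := fun m => Nat.find_min hex (m := m)
  generalize Nat.find hex = n at h1 h2 hmin
  have heq : 2 / δ * (δ / 2 ^ n) = 2 / 2 ^ n := by field_simp
  rw [heq]
  obtain ⟨m, rfl⟩ : ∃ m, n = m + 1 := ⟨n - 1, by omega⟩
  have heq2 : (2 : ℝ) / 2 ^ (m + 1) = 1 / 2 ^ m := by
    rw [pow_succ]
    field_simp
  rw [heq2]
  rcases Nat.eq_zero_or_pos m with rfl | hm
  · simpa using hρ
  · have h3 := hmin m (Nat.lt_succ_self m)
    rw [not_and, not_le] at h3
    refine (h3 hm).le.trans ?_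
    gcongr

/-- Only the zero over `ξ j` at the dyadic scale of `1 - |z|` is used; all other factors are bounded
by `1`. -/
theorem norm_sq_radialBlaschke_le (hξ : ∀ j, ‖ξ j‖ = 1) (hδ : 0 < δ) (hδ1 : δ ≤ 1) {N : ℕ}
    (hN : 1 ≤ N) (d : ℕ) {C : ℝ} (hC : 0 < C) {z : ℂ} (hz : ‖z‖ ≤ 1) {j : Fin p}
    (hzξ : ‖z - ξ j‖ ≤ C * (1 - ‖z‖)) (hzN : δ / 2 ^ N ≤ 1 - ‖z‖) :
    ‖radialBlaschke ξ δ N d z‖ ^ 2 ≤ (1 - 1 / (C * (2 / δ) + 1) ^ 2) ^ d := by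
  obtain ⟨n, hn, h1, h2⟩ := exists_dyadic_scale hδ hδ1 hN
    (by linarith [norm_nonneg z] : 1 - ‖z‖ ≤ 1) hzN
  have hn1 := (Finset.mem_Icc.1 hn).1
  have hhalf := div_two_pow_le_half hn1 hδ1
  have hfac := norm_sq_blaschkeFactor_le_of_stolz (hξ j) hz hC hzξ (by positivity)
    (by linarith) h1 h2
  have hmem : (j, n) ∈ (Finset.univ : Finset (Fin p)) ×ˢ Finset.Icc 1 N :=
    Finset.mem_product.2 ⟨Finset.mem_univ j, hn⟩
  have hle : ‖radialBlaschke ξ δ N d z‖ ≤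
      ‖blaschkeFactor ((1 - δ / 2 ^ n : ℝ) * ξ j) z ^ d‖ := by
    rw [radialBlaschke, ← Finset.mul_prod_erase _ _ hmem, norm_mul]
    refine mul_le_of_le_one_right (norm_nonneg _) ?_
    rw [norm_prod]
    refine Finset.prod_le_one (fun _ _ => norm_nonneg _) fun i hi => ?_
    rw [norm_pow]
    exact pow_le_one₀ (norm_nonneg _) (norm_blaschkeFactor_le_one (norm_radial_zero_lt_one hξ hδ hδ1
      (Finset.mem_Icc.1 (Finset.mem_product.1 (Finset.mem_of_mem_erase hi)).2).1 i.1) hz)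
  calc ‖radialBlaschke ξ δ N d z‖ ^ 2
      ≤ ‖blaschkeFactor ((1 - δ / 2 ^ n : ℝ) * ξ j) z ^ d‖ ^ 2 := by gcongr
    _ = (‖blaschkeFactor ((1 - δ / 2 ^ n : ℝ) * ξ j) z‖ ^ 2) ^ d := by
        rw [norm_pow, ← pow_mul, ← pow_mul, Nat.mul_comm]
    _ ≤ _ := by gcongr

end BlaschkeProduct

/-! ### The main estimate -/

section MainEstimate

open MeasureTheory

/-- Serves to get `ω⁻¹(y) ≤ y` for small `y`, so that the logarithm in `d_N` is nonnegative. -/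
theorem IsModulusOfContinuity.exists_le_map {A : ℝ} {ω : ℝ → ℝ} (hω : IsModulusOfContinuity A ω)
    (hω' : Tendsto (fun h : ℝ => ω h / h) (𝓝[>] 0) atTop) :
    ∃ a, 0 < a ∧ a ≤ A ∧ ∀ x ∈ Ioc 0 a, x ≤ ω x := by
  have h := hω'.eventually_ge_atTop 1
  rw [eventually_nhdsWithin_iff] at h
  obtain ⟨a, ha, hball⟩ := Metric.eventually_nhds_iff.1 h
  refine ⟨min (a / 2) A, lt_min (by positivity) hω.pos, min_le_right _ _, fun x hx => ?_⟩
  have hx2 : x ≤ a / 2 := hx.2.trans (min_le_left _ _)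
  have := hball (y := x) (by rw [Real.dist_eq, sub_zero, abs_of_pos hx.1]; linarith) hx.1
  rwa [one_le_div hx.1] at this

/-- A weight that is at most `1`, and at most `θ` where the curve is at distance at least `δ` from
the circle, satisfies a Carleson condition. -/
theorem integral_weight_le {X : Type*} [MeasurableSpace X] {μ : Measure X} [IsFiniteMeasure μ]
    {w ρ : X → ℝ} {θ δ r a b : ℝ} (hw : Integrable w μ) (hw1 : ∀ x, w x ≤ 1) (hθ : 0 ≤ θ)
    (hρ : Measurable ρ) (hwθ : ∀ᵐ x ∂μ, δ < ρ x → w x ≤ θ)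
    (ha : μ.real {x | ρ x ≤ r} ≤ a) (hb : μ.real {x | ρ x ≤ min r δ} ≤ b) :
    ∫ x in {x | ρ x ≤ r}, w x ∂μ ≤ θ * a + b := by
  have hm : ∀ s, MeasurableSet {x | ρ x ≤ s} := fun s => measurableSet_le hρ measurable_const
  have hint : Integrable (fun x => θ + ({x | ρ x ≤ δ}.indicator (fun _ => (1 : ℝ)) x))
      (μ.restrict {x | ρ x ≤ r}) :=
    (integrable_const θ).add ((integrable_const 1).indicator (hm δ))
  calc ∫ x in {x | ρ x ≤ r}, w x ∂μ
      ≤ ∫ x in {x | ρ x ≤ r}, (θ + ({x | ρ x ≤ δ}.indicator (fun _ => (1 : ℝ)) x)) ∂μ := by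
        refine integral_mono_ae hw.restrict hint ?_
        filter_upwards [ae_restrict_of_ae hwθ] with x hx
        by_cases h : ρ x ≤ δ
        · rw [indicator_of_mem (by exact h)]
          linarith [hw1 x]
        · rw [indicator_of_notMem (by exact h), add_zero]
          exact hx (not_le.1 h)
    _ = θ * μ.real {x | ρ x ≤ r} + μ.real {x | ρ x ≤ min r δ} := by
        rw [integral_add (integrable_const θ) ((integrable_const 1).indicator (hm δ)),
          integral_const, integral_indicator (hm δ), Measure.restrict_restrict (hm δ),
          setIntegral_const, measureReal_restrict_apply_univ, smul_eq_mul, smul_eq_mul, mul_one,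
          mul_comm θ]
        congr 2
        ext x
        simp [and_comm]
    _ ≤ _ := by gcongr

theorem exists_approxNumber_le {φ : ℂ → ℂ} (hφ : IsDiskAlgebraSymbol φ)
    {p : ℕ} {ξ : Fin p → ℂ} (hξ : ∀ j, ‖ξ j‖ = 1) {A : ℝ} {ω : ℝ → ℝ}
    (hω : IsModulusOfContinuity A ω)
    (hω' : Tendsto (fun h : ℝ => ω h / h) (𝓝[>] 0) atTop)
    (hreg : IsGloballyRegular φ ξ A ω) :
    ∃ T : HardyH2 →L[ℂ] HardyH2, IsCompositionOperator φ T ∧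
      ∃ κ > 0, ∃ σ > 0, ∃ K > 0, κ ≤ ω A ∧
        (∀ N : ℕ, modulusInv A ω (κ / 2 ^ N) ≤ κ / 2 ^ N) ∧
        ∀ q N : ℕ, 1 ≤ N → (p : ℤ) * N * dNumber A ω σ κ N < q →
          approxNumber q T ≤ K * √(modulusInv A ω (κ / 2 ^ N) / (κ / 2 ^ N)) := by
  obtain ⟨S, C, hC, L, hL, hS⟩ := hreg.exists_finset hω
  have hS' : ∀ t ∈ Ioc 0 (2 * Real.pi), ∃ s ∈ S, |t - s| ≤ A ∧
      ω |t - s| ≤ L * (1 - ‖boundaryCurve φ t‖) := fun t ht => by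
    obtain ⟨j, s, hs, h1, h2, -⟩ := hS t ht
    exact ⟨s, hs, h1, h2⟩
  have hγ := hφ.continuous_boundaryCurve.measurable
  set μ := volume.restrict (Ioc 0 (2 * Real.pi)) with hμ
  -- The weight `1` already satisfies the Carleson condition, with constant `M`.
  obtain ⟨M, hM, hμM⟩ := exists_measureReal_one_sub_norm_le hω hL hS' hγ
  obtain ⟨T, hT⟩ := IsRadialCarleson.exists_isCompositionOperator hφ hM.le (by
    intro r hr
    simpa using hμM r hr)
  obtain ⟨a, ha0, haA, ha⟩ := hω.exists_le_map hω'
  have hωa : 0 < ω a := hω.map_pos ha0 haA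
  -- `δ ≤ 1` keeps the zeros in the disk. `δ ≤ ω a / L` gives `κ = L δ ≤ ω a`, the range where
  -- `ω⁻¹(y) ≤ y`; and distance `δ 2⁻ᴺ` to the circle corresponds to the value `κ 2⁻ᴺ` of the
  -- modulus.
  set δ := min 1 (ω a / L) with hδ
  have hδ0 : 0 < δ := lt_min one_pos (by positivity)
  have hδ1 : δ ≤ 1 := min_le_left _ _
  set κ := L * δ with hκ
  have hκ0 : 0 < κ := by positivity
  have hκa : κ ≤ ω a := by
    have : δ ≤ ω a / L := min_le_right _ _
    rwa [le_div_iff₀ hL, mul_comm] at this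
  have hκA : κ ≤ ω A :=
    hκa.trans (hω.strictMonoOn.monotoneOn ⟨ha0.le, haA⟩ ⟨hω.pos.le, le_rfl⟩ haA)
  have hκN : ∀ N : ℕ, κ / 2 ^ N ≤ κ := fun N =>
    div_le_self hκ0.le (one_le_pow₀ (by norm_num))
  have hinv0 : ∀ N : ℕ, 0 < modulusInv A ω (κ / 2 ^ N) := fun N =>
    hω.inv_pos (by positivity) ((hκN N).trans hκA)
  have hinv : ∀ N : ℕ, modulusInv A ω (κ / 2 ^ N) ≤ κ / 2 ^ N := fun N => by
    have h1 : modulusInv A ω (κ / 2 ^ N) ≤ a :=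
      hω.inv_le ⟨ha0.le, haA⟩ (by positivity) ((hκN N).trans hκa)
    have h2 := ha _ ⟨hinv0 N, h1⟩
    rwa [hω.map_inv (by positivity) ((hκN N).trans hκA)] at h2
  set θ := 1 - 1 / (C * (2 / δ) + 1) ^ 2 with hθ
  have hpos : 0 < C * (2 / δ) := by positivity
  have hθ0 : 0 < θ := by
    rw [hθ, sub_pos, div_lt_one (by positivity)]
    nlinarith
  have hθ1 : θ < 1 := by
    rw [hθ, sub_lt_self_iff]
    positivity
  have hlog : Real.log θ < 0 := Real.log_neg hθ0 hθ1
  -- `σ` is such that `d > σ log (1/ε)` forces `θ^d ≤ ε`. In the last constant, `M` comes from the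
  -- region where the product is small and `4 |S| L` from the region next to the circle.
  refine ⟨T, hT, κ, hκ0, -1 / Real.log θ, div_pos_of_neg_of_neg (by norm_num) hlog,
    √(16 * (M + 4 * S.card * L)), by positivity, hκA, hinv, fun q N hN hq => ?_⟩
  set ε := modulusInv A ω (κ / 2 ^ N) / (κ / 2 ^ N) with hε
  have hε0 : 0 < ε := div_pos (hinv0 N) (by positivity)
  have hε1 : ε ≤ 1 := div_le_one_of_le₀ (hinv N) (by positivity)
  have hd0 : 0 ≤ dNumber A ω (-1 / Real.log θ) κ N := by
    rw [dNumber]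
    have h1 : 0 ≤ Real.log ((κ / 2 ^ N) / modulusInv A ω (κ / 2 ^ N)) :=
      Real.log_nonneg ((one_le_div (hinv0 N)).2 (hinv N))
    have h2 : 0 ≤ -1 / Real.log θ := (div_pos_of_neg_of_neg (by norm_num) hlog).le
    have := Int.floor_nonneg.2 (mul_nonneg h2 h1)
    linarith
  obtain ⟨d, hd⟩ := Int.eq_ofNat_of_zero_le hd0
  have hθd : θ ^ d ≤ ε := by
    have h1 : -1 / Real.log θ * Real.log ((κ / 2 ^ N) / modulusInv A ω (κ / 2 ^ N)) < d := by
      have h2 := Int.lt_floor_add_one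
        (-1 / Real.log θ * Real.log ((κ / 2 ^ N) / modulusInv A ω (κ / 2 ^ N)))
      have h3 : ((dNumber A ω (-1 / Real.log θ) κ N : ℤ) : ℝ) = d := by rw [hd]; simp
      rw [dNumber] at h3
      push_cast at h3
      linarith
    have h2 : (κ / 2 ^ N) / modulusInv A ω (κ / 2 ^ N) = ε⁻¹ := by rw [hε, inv_div]
    rw [h2, Real.log_inv] at h1
    have h4 : d * Real.log θ ≤ Real.log ε := by
      have := mul_le_mul_of_nonpos_right h1.le hlog.le
      have h5 : -1 / Real.log θ * -Real.log ε * Real.log θ = Real.log ε := by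
        field_simp [hlog.ne]
      linarith
    rw [← Real.log_pow] at h4
    exact (Real.log_le_log_iff (by positivity) hε0).1 h4
  rw [hd] at hq
  have hE : 0 ≤ (M + 4 * S.card * L) * ε := by positivity
  have hcarl : IsRadialCarleson φ (fun z => radialBlaschke ξ δ N d (φ z))
      ((M + 4 * S.card * L) * ε) := by
    intro r hr
    have hnear : μ.real {t | 1 - ‖boundaryCurve φ t‖ ≤ min r (δ / 2 ^ N)} ≤
        4 * S.card * L * ε * r := by
      have hmin : 0 < min r (δ / 2 ^ N) := lt_min hr (by positivity)
      have hLκ : L * min r (δ / 2 ^ N) ≤ κ / 2 ^ N := by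
        calc L * min r (δ / 2 ^ N) ≤ L * (δ / 2 ^ N) := by gcongr; exact min_le_right _ _
          _ = κ / 2 ^ N := by rw [hκ]; ring
      refine (measureReal_one_sub_norm_le hω hL hS' hγ hmin
        (hLκ.trans ((hκN N).trans hκA))).trans ?_
      have h1 := hω.inv_mul_le (mul_pos hL hmin) hLκ ((hκN N).trans hκA)
      have h2 : modulusInv A ω (L * min r (δ / 2 ^ N)) ≤ 2 * (L * r) * ε := by
        rw [hε, mul_div_assoc', le_div_iff₀ (by positivity)]
        refine h1.trans ?_
        gcongr
        · exact (hinv0 N).le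
        · exact min_le_left _ _
      calc 2 * S.card * modulusInv A ω (L * min r (δ / 2 ^ N))
          ≤ 2 * S.card * (2 * (L * r) * ε) := by gcongr
        _ = _ := by ring
    have hdiff := diffContOnCl_radialBlaschke_comp hφ hξ hδ0 hδ1 N d
    have hw : Integrable (fun t : ℝ =>
        ‖radialBlaschke ξ δ N d (φ (Complex.exp (t * Complex.I)))‖ ^ 2) μ :=
      ((hdiff.continuous_circle.norm.pow 2).integrableOn_Icc (a := 0)
        (b := 2 * Real.pi)).mono_set Ioc_subset_Icc_self
    have hmain := integral_weight_le (μ := μ) (ρ := fun t => 1 - ‖boundaryCurve φ t‖) (δ := δ / 2 ^ N)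
      (θ := θ ^ d) hw
      (fun t => pow_le_one₀ (norm_nonneg _)
        (norm_radialBlaschke_le_one hξ hδ0 hδ1 N d (hφ.norm_boundaryCurve_le t)))
      (by positivity) (measurable_const.sub hγ.norm) ?_ (hμM r hr) hnear
    · refine hmain.trans ?_
      calc θ ^ d * (M * r) + 4 * S.card * L * ε * r
          ≤ ε * (M * r) + 4 * S.card * L * ε * r := by gcongr
        _ = _ := by ring
    · filter_upwards [ae_restrict_mem measurableSet_Ioc] with t ht hlt
      obtain ⟨j, s, -, -, -, h3⟩ := hS t ht
      exact norm_sq_radialBlaschke_le hξ hδ0 hδ1 hN d hC (hφ.norm_boundaryCurve_le t) h3 hlt.le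
  have hmq : p * N * d < q := by exact_mod_cast hq
  refine (hT.approxNumber_le hφ (isMultiplierOfDefect_radialBlaschke hξ hδ0 hδ1 N d)
    (diffContOnCl_radialBlaschke_comp hφ hξ hδ0 hδ1 N d) hE hcarl hmq).trans (le_of_eq ?_)
  rw [← mul_assoc, Real.sqrt_mul (by positivity)]

end MainEstimate

/-! ### Existence of `N_q`, and decay rates from index growth -/

theorem exists_isNq {p : ℕ} (hp : 1 ≤ p) {d : ℕ → ℤ} (hd : ∀ N, 1 ≤ d N) (q : ℕ) :
    ∃ N, IsNq p d q N := by
  rcases Set.eq_empty_or_nonempty {M : ℕ | 1 ≤ M ∧ (p : ℤ) * M * d M < q} with h | h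
  · exact ⟨1, Or.inr ⟨h, rfl⟩⟩
  · have hbdd : BddAbove {M : ℕ | 1 ≤ M ∧ (p : ℤ) * M * d M < q} := by
      refine ⟨q, fun M hM => ?_⟩
      have h1 : (1 : ℤ) ≤ p := by exact_mod_cast hp
      have h2 : (M : ℤ) ≤ p * M * d M := by
        have h3 : (M : ℤ) ≤ p * M := le_mul_of_one_le_left (by positivity) h1
        exact h3.trans (le_mul_of_one_le_right (by positivity) (hd M))
      have := h2.trans_lt hM.2
      exact_mod_cast this.le
    exact ⟨sSup _, Or.inl ⟨Nat.sSup_mem h hbdd, fun M hM => le_csSup hbdd hM⟩⟩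

/-- A sequence that is `O(e^{-cN})` at the indices beyond `C N²` decays like `e^{-β √n}`. -/
theorem exists_le_exp_neg_sqrt {x : ℕ → ℝ} {X C c K : ℝ} {N₀ : ℕ} (hX : 0 ≤ X) (hC : 0 < C)
    (hc : 0 < c) (hK : 0 ≤ K) (hx : ∀ n, 1 ≤ n → x n ≤ X)
    (h : ∀ n N : ℕ, N₀ ≤ N → C * N ^ 2 < n → x n ≤ K * Real.exp (-c * N)) :
    ∃ a > 0, ∃ β > 0, ∀ n : ℕ, 1 ≤ n → x n ≤ a * Real.exp (-β * √n) := by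
  refine ⟨K * Real.exp c + X * Real.exp (c * N₀) + 1, by positivity, c / √(2 * C), by positivity,
    fun n hn => ?_⟩
  have hn0 : (0 : ℝ) < n := by exact_mod_cast hn
  -- Chosen so that `C R² = n / 2 < n`, hence `N = ⌊R⌋` is admissible. If `N < N₀`, then `R` is
  -- bounded and the term `X e^{c N₀}` absorbs the trivial bound.
  set R := √n / √(2 * C) with hR
  have hR0 : 0 ≤ R := by positivity
  have hR2 : C * R ^ 2 = n / 2 := by
    rw [hR, div_pow, Real.sq_sqrt hn0.le, Real.sq_sqrt (by positivity)]
    field_simp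
  have hexp : -(c / √(2 * C)) * √n = -c * R := by rw [hR]; ring
  rw [hexp]
  set N := ⌊R⌋₊ with hN
  have hN1 : (N : ℝ) ≤ R := Nat.floor_le hR0
  have hN2 : R < N + 1 := Nat.lt_floor_add_one R
  rcases le_or_gt N₀ N with h0 | h0
  · have h1 : C * (N : ℝ) ^ 2 < n := by
      calc C * (N : ℝ) ^ 2 ≤ C * R ^ 2 := by gcongr
        _ < (n : ℝ) := by rw [hR2]; linarith
    calc x n ≤ K * Real.exp (-c * N) := h n N h0 h1
      _ ≤ K * (Real.exp c * Real.exp (-c * R)) := by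
        rw [← Real.exp_add]
        gcongr
        nlinarith
      _ = K * Real.exp c * Real.exp (-c * R) := by ring
      _ ≤ _ := by
        gcongr
        have : 0 ≤ X * Real.exp (c * N₀) := by positivity
        linarith
  · have h1 : (N : ℝ) + 1 ≤ N₀ := by exact_mod_cast h0
    calc x n ≤ X * 1 := by rw [mul_one]; exact hx n hn
      _ ≤ X * (Real.exp (c * N₀) * Real.exp (-c * R)) := by
        rw [← Real.exp_add]
        gcongr
        refine Real.one_le_exp ?_
        nlinarith
      _ = X * Real.exp (c * N₀) * Real.exp (-c * R) := by ring
      _ ≤ _ := by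
        gcongr
        have : 0 ≤ K * Real.exp c := by positivity
        linarith

/-- A sequence that is `O(e^{-cΛ^N})` at the indices beyond `C N Λ^N` decays like
`e^{-β n / log n}`. -/
theorem exists_le_exp_neg_div_log {x : ℕ → ℝ} {X C c K Λ : ℝ} {N₀ : ℕ} (hX : 0 ≤ X) (hC : 0 < C)
    (hc : 0 < c) (hK : 0 ≤ K) (hΛ : 1 < Λ) (hx : ∀ n, 1 ≤ n → x n ≤ X)
    (h : ∀ n N : ℕ, N₀ ≤ N → C * (N * Λ ^ N) < n → x n ≤ K * Real.exp (-c * Λ ^ N)) :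
    ∃ a > 0, ∃ β > 0, ∀ n : ℕ, 2 ≤ n → x n ≤ a * Real.exp (-β * n / Real.log n) := by
  have hΛ0 : 0 < Λ := by linarith
  have hlogΛ : 0 < Real.log Λ := Real.log_pos hΛ
  have hlog2 : 0 < Real.log 2 := Real.log_pos (by norm_num)
  -- With `R = δ n / log n` and `Λ^N ≤ R < Λ^(N+1)`, the first bound gives `R ≤ n`, so `N log Λ ≤
  -- log n`; the second then gives `C N Λ^N ≤ n / 2`.
  set δ := min (Real.log 2) (Real.log Λ / (2 * C)) with hδ
  have hδ0 : 0 < δ := lt_min hlog2 (by positivity)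
  have hδ2 : δ ≤ Real.log 2 := min_le_left _ _
  have hδΛ : C * δ ≤ Real.log Λ / 2 := by
    calc C * δ ≤ C * (Real.log Λ / (2 * C)) := by gcongr; exact min_le_right _ _
      _ = _ := by field_simp
  refine ⟨K + X * Real.exp (c * Λ ^ N₀) + 1, by positivity, c * δ / Λ, by positivity,
    fun n hn => ?_⟩
  have hn2 : (2 : ℝ) ≤ n := by exact_mod_cast hn
  have hn0 : (0 : ℝ) < n := by linarith
  have hlogn2 : Real.log 2 ≤ Real.log n := Real.log_le_log two_pos hn2
  have hlogn : 0 < Real.log n := hlog2.trans_le hlogn2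
  set R := δ * n / Real.log n with hR
  have hR0 : 0 < R := by positivity
  have hexp : -(c * δ / Λ) * n / Real.log n = -c * (R / Λ) := by rw [hR]; ring
  rw [hexp]
  rcases le_or_gt (Λ ^ N₀) R with h0 | h0
  · obtain ⟨N, hN1, hN2⟩ := exists_nat_pow_near ((one_le_pow₀ hΛ.le).trans h0) hΛ
    have hNN : N₀ ≤ N := Nat.lt_succ_iff.1 ((pow_lt_pow_iff_right₀ hΛ).1 (h0.trans_lt hN2))
    have hRn : R ≤ n := by
      rw [hR, div_le_iff₀ hlogn, mul_comm]
      gcongr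
      exact hδ2.trans hlogn2
    have hNlog : N * Real.log Λ ≤ Real.log n := by
      rw [← Real.log_pow]
      exact Real.log_le_log (by positivity) (hN1.trans hRn)
    have h1 : C * (N * Λ ^ N) < n := by
      have h2 : R * Real.log n = δ * n := by rw [hR]; field_simp
      have h3 : C * (N * Λ ^ N) * Real.log Λ ≤ Real.log Λ / 2 * n := by
        calc C * (N * Λ ^ N) * Real.log Λ = C * (Λ ^ N * (N * Real.log Λ)) := by ring
          _ ≤ C * (R * Real.log n) := by gcongr
          _ = C * δ * n := by rw [h2]; ring
          _ ≤ _ := by gcongr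
      nlinarith [mul_pos hlogΛ hn0]
    calc x n ≤ K * Real.exp (-c * Λ ^ N) := h n N hNN h1
      _ ≤ K * Real.exp (-c * (R / Λ)) := by
        gcongr K * Real.exp ?_
        have : R / Λ ≤ Λ ^ N := by
          rw [div_le_iff₀ hΛ0, ← pow_succ]
          exact hN2.le
        nlinarith
      _ ≤ _ := by
        gcongr
        have : 0 ≤ X * Real.exp (c * Λ ^ N₀) := by positivity
        linarith
  · calc x n ≤ X * 1 := by rw [mul_one]; exact hx n (by omega)
      _ ≤ X * (Real.exp (c * Λ ^ N₀) * Real.exp (-c * (R / Λ))) := by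
        rw [← Real.exp_add]
        gcongr
        refine Real.one_le_exp ?_
        have : R / Λ ≤ Λ ^ N₀ := (div_le_self hR0.le hΛ.le).trans h0.le
        nlinarith
      _ = X * Real.exp (c * Λ ^ N₀) * Real.exp (-c * (R / Λ)) := by ring
      _ ≤ _ := by
        gcongr
        linarith

/-! ### Power and logarithmic moduli -/

section SpecialModuli

variable {A κ σ K X : ℝ} {ω : ℝ → ℝ} {p : ℕ} {x : ℕ → ℝ}

theorem Filter.Eventually.exists_Ioc_of_nhdsGT {P : ℝ → Prop} (h : ∀ᶠ t in 𝓝[>] (0 : ℝ), P t)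
    {b : ℝ} (hb : 0 < b) : ∃ a, 0 < a ∧ a ≤ b ∧ ∀ t ∈ Ioc 0 a, P t := by
  obtain ⟨u, hu, hP⟩ := (mem_nhdsGT_iff_exists_Ioc_subset).1 h
  exact ⟨min u b, lt_min hu hb, min_le_right _ _,
    fun t ht => hP ⟨ht.1, ht.2.trans (min_le_left _ _)⟩⟩

theorem exists_forall_div_two_pow_le (κ : ℝ) {y : ℝ} (hy : 0 < y) :
    ∃ N₀ : ℕ, ∀ N ≥ N₀, κ / 2 ^ N ≤ y := by
  have h : Tendsto (fun N : ℕ => κ / (2 : ℝ) ^ N) atTop (𝓝 0) :=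
    (tendsto_pow_atTop_atTop_of_one_lt (by norm_num)).const_div_atTop κ
  exact eventually_atTop.1 (h.eventually (eventually_le_nhds hy))

theorem dNumber_mul_lt {N n : ℕ} (h : (p : ℝ) * N *
      (σ * -Real.log (modulusInv A ω (κ / 2 ^ N) / (κ / 2 ^ N)) + 1) < n) :
    (p : ℤ) * N * dNumber A ω σ κ N < n := by
  have h1 : (dNumber A ω σ κ N : ℝ) ≤
      σ * -Real.log (modulusInv A ω (κ / 2 ^ N) / (κ / 2 ^ N)) + 1 := by
    rw [dNumber, ← Real.log_inv, inv_div]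
    push_cast
    linarith [Int.floor_le
      (σ * Real.log ((κ / 2 ^ N) / modulusInv A ω (κ / 2 ^ N)))]
  have h2 : (p : ℝ) * N * (dNumber A ω σ κ N : ℝ) < n :=
    (mul_le_mul_of_nonneg_left h1 (by positivity)).trans_lt h
  exact_mod_cast h2

/-- Here `ω⁻¹(y) = y^(1/θ)` for small `y`, so `log (ω⁻¹(y)/y) = b log y` with `b = (1 - θ)/θ`. Thus
`d_N = O(N)`, the degree is `O(N²)`, and the bound is of order `2^(-bN/2)`. -/
theorem IsModulusOfContinuity.exists_le_exp_of_rpow (hω : IsModulusOfContinuity A ω) {θ : ℝ}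
    (hθ0 : 0 < θ) (hθ1 : θ < 1) (hωθ : ∀ᶠ h in 𝓝[>] (0 : ℝ), ω h = h ^ θ) (hκ : 0 < κ)
    (hκA : κ ≤ ω A) (hσ : 0 < σ) (hK : 0 < K) (hX : 0 ≤ X) (hx : ∀ n, 1 ≤ n → x n ≤ X)
    (hmain : ∀ q N : ℕ, 1 ≤ N → (p : ℤ) * N * dNumber A ω σ κ N < q →
      x q ≤ K * √(modulusInv A ω (κ / 2 ^ N) / (κ / 2 ^ N))) :
    ∃ a > 0, ∃ β > 0, ∀ n : ℕ, 1 ≤ n → x n ≤ a * Real.exp (-β * √n) := by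
  obtain ⟨h₀, hh0, hhA, hh⟩ := hωθ.exists_Ioc_of_nhdsGT hω.pos
  obtain ⟨N₀, hN₀⟩ := exists_forall_div_two_pow_le κ (hω.map_pos hh0 hhA)
  have hlog2 : 0 < Real.log 2 := Real.log_pos (by norm_num)
  set b := (1 - θ) / θ with hb
  have hb0 : 0 < b := div_pos (by linarith) hθ0
  have hκN : ∀ N : ℕ, κ / 2 ^ N ≤ κ := fun N =>
    div_le_self hκ.le (one_le_pow₀ (by norm_num))
  have hlog : ∀ N ≥ N₀, Real.log (modulusInv A ω (κ / 2 ^ N) / (κ / 2 ^ N)) =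
      b * (Real.log κ - N * Real.log 2) := by
    intro N hN
    have hy : 0 < κ / 2 ^ N := by positivity
    have hz := hω.inv_pos hy ((hκN N).trans hκA)
    have hz2 := hω.inv_le ⟨hh0.le, hhA⟩ hy.le (hN₀ N hN)
    have h1 := hω.map_inv hy.le ((hκN N).trans hκA)
    rw [hh _ ⟨hz, hz2⟩] at h1
    have h2 := congrArg Real.log h1
    rw [Real.log_rpow hz] at h2
    have h3 : Real.log (κ / 2 ^ N) = Real.log κ - N * Real.log 2 := by
      rw [Real.log_div hκ.ne' (by positivity), Real.log_pow]
    rw [Real.log_div hz.ne' hy.ne', h3, hb]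
    rw [h3] at h2
    rw [← h2]
    field_simp
  set D := σ * b * (|Real.log κ| + Real.log 2) + 1 with hD
  have hD0 : 0 < D := by positivity
  refine exists_le_exp_neg_sqrt (X := X) (C := p * D + 1) (c := b * Real.log 2 / 2)
    (K := K * Real.exp (b * Real.log κ / 2)) (N₀ := max N₀ 1) hX (by positivity) (by positivity)
    (by positivity) hx fun n N hN hn => ?_
  have hN1 : 1 ≤ N := (le_max_right _ _).trans hN
  have hN1' : (1 : ℝ) ≤ N := by exact_mod_cast hN1
  have hNl := hlog N ((le_max_left _ _).trans hN)
  have hle : (p : ℝ) * N *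
      (σ * -Real.log (modulusInv A ω (κ / 2 ^ N) / (κ / 2 ^ N)) + 1) < n := by
    rw [hNl]
    have h1 : σ * -(b * (Real.log κ - N * Real.log 2)) + 1 ≤ D * N := by
      have h2 : -Real.log κ ≤ |Real.log κ| * N :=
        (neg_le_abs _).trans (le_mul_of_one_le_right (abs_nonneg _) hN1')
      have h3 : σ * b * -Real.log κ ≤ σ * b * (|Real.log κ| * N) := by gcongr
      rw [hD]
      linarith
    calc (p : ℝ) * N * (σ * -(b * (Real.log κ - N * Real.log 2)) + 1)
        ≤ p * N * (D * N) := by gcongr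
      _ ≤ (p * D + 1) * N ^ 2 := by nlinarith [sq_nonneg (N : ℝ)]
      _ < n := hn
  refine (hmain n N hN1 (dNumber_mul_lt hle)).trans (le_of_eq ?_)
  have hpos : 0 < modulusInv A ω (κ / 2 ^ N) / (κ / 2 ^ N) :=
    div_pos (hω.inv_pos (by positivity) ((hκN N).trans hκA)) (by positivity)
  rw [← Real.exp_log hpos, hNl, ← Real.exp_half, mul_assoc, ← Real.exp_add]
  congr 2
  ring

/-- Here `ω⁻¹(y) = exp (-y^(-1/α))` for small `y`, so `ω⁻¹(κ 2⁻ᴺ) = exp (-c Λ^N)` with `Λ =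
2^(1/α)`, and the degree is `O(N Λ^N)`. -/
theorem IsModulusOfContinuity.exists_le_exp_of_log (hω : IsModulusOfContinuity A ω) {α : ℝ}
    (hα : 0 < α) (hωα : ∀ᶠ h in 𝓝[>] (0 : ℝ), ω h = 1 / Real.log (1 / h) ^ α) (hκ : 0 < κ)
    (hκA : κ ≤ ω A) (hσ : 0 < σ) (hK : 0 < K) (hX : 0 ≤ X) (hx : ∀ n, 1 ≤ n → x n ≤ X)
    (hmain : ∀ q N : ℕ, 1 ≤ N → (p : ℤ) * N * dNumber A ω σ κ N < q →
      x q ≤ K * √(modulusInv A ω (κ / 2 ^ N) / (κ / 2 ^ N))) :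
    ∃ a > 0, ∃ β > 0, ∀ n : ℕ, 2 ≤ n → x n ≤ a * Real.exp (-β * n / Real.log n) := by
  obtain ⟨h₀, hh0, hhA1, hh⟩ := hωα.exists_Ioc_of_nhdsGT (lt_min hω.pos one_pos)
  have hhA : h₀ ≤ A := hhA1.trans (min_le_left _ _)
  have hh1 : h₀ ≤ 1 := hhA1.trans (min_le_right _ _)
  obtain ⟨N₀, hN₀⟩ := exists_forall_div_two_pow_le κ (hω.map_pos hh0 hhA)
  have hlog2 : 0 < Real.log 2 := Real.log_pos (by norm_num)
  set Λ : ℝ := 2 ^ α⁻¹ with hΛ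
  have hΛ1 : 1 < Λ := Real.one_lt_rpow (by norm_num) (by positivity)
  have hΛ0 : 0 < Λ := by linarith
  set c := (κ⁻¹) ^ α⁻¹ with hc
  have hc0 : 0 < c := by positivity
  have hκN : ∀ N : ℕ, κ / 2 ^ N ≤ κ := fun N =>
    div_le_self hκ.le (one_le_pow₀ (by norm_num))
  have hlog : ∀ N ≥ N₀, Real.log (modulusInv A ω (κ / 2 ^ N) / (κ / 2 ^ N)) =
      -(c * Λ ^ N) - Real.log κ + N * Real.log 2 := by
    intro N hN
    have hy : 0 < κ / 2 ^ N := by positivity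
    have hz := hω.inv_pos hy ((hκN N).trans hκA)
    have hz2 := hω.inv_le ⟨hh0.le, hhA⟩ hy.le (hN₀ N hN)
    have h1 := hω.map_inv hy.le ((hκN N).trans hκA)
    rw [hh _ ⟨hz, hz2⟩, one_div, one_div, Real.log_inv] at h1
    have hnn : 0 ≤ -Real.log (modulusInv A ω (κ / 2 ^ N)) := by
      have := Real.log_nonpos hz.le (hz2.trans hh1)
      linarith
    have h2 : (-Real.log (modulusInv A ω (κ / 2 ^ N))) ^ α = (κ / 2 ^ N)⁻¹ :=
      inv_eq_iff_eq_inv.1 h1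
    have h4 : -Real.log (modulusInv A ω (κ / 2 ^ N)) = c * Λ ^ N := by
      rw [← Real.rpow_rpow_inv hnn hα.ne', h2, inv_div, div_eq_mul_inv, mul_comm,
        Real.mul_rpow (by positivity) (by positivity), hc, hΛ, ← Real.rpow_natCast,
        ← Real.rpow_natCast, ← Real.rpow_mul (by norm_num), ← Real.rpow_mul (by norm_num),
        mul_comm (N : ℝ)]
    have h3 : Real.log (κ / 2 ^ N) = Real.log κ - N * Real.log 2 := by
      rw [Real.log_div hκ.ne' (by positivity), Real.log_pow]
    rw [Real.log_div hz.ne' hy.ne', h3, ← h4]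
    ring
  -- Dividing by `κ 2⁻ᴺ` costs `N log 2`, absorbed by half of `c Λ^N`; the square root halves the
  -- rest, whence the rate `c / 4`.
  obtain ⟨N₁, hN₁⟩ : ∃ N₁ : ℕ, ∀ N ≥ N₁, N * Real.log 2 ≤ c / 2 * Λ ^ N := by
    have h := (tendsto_pow_const_div_const_pow_of_one_lt 1 hΛ1).eventually
      (eventually_le_nhds (by positivity : 0 < c / 2 / Real.log 2))
    obtain ⟨N₁, hN₁⟩ := eventually_atTop.1 h
    refine ⟨N₁, fun N hN => ?_⟩
    have h1 := hN₁ N hN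
    rw [pow_one, div_le_iff₀ (by positivity), div_mul_eq_mul_div, le_div_iff₀ hlog2] at h1
    exact h1
  set D := σ * (c + |Real.log κ|) + 1 with hD
  have hD0 : 0 < D := by positivity
  refine exists_le_exp_neg_div_log (X := X) (C := p * D + 1) (c := c / 4) (Λ := Λ)
    (K := K * Real.exp (-Real.log κ / 2)) (N₀ := max (max N₀ N₁) 1) hX (by positivity)
    (by positivity) (by positivity) hΛ1 hx fun n N hN hn => ?_
  have hN1 : 1 ≤ N := (le_max_right _ _).trans hN
  have hN1' : (1 : ℝ) ≤ N := by exact_mod_cast hN1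
  have hNN := (le_max_left _ _).trans hN
  have hNl := hlog N ((le_max_left _ _).trans hNN)
  have hNe := hN₁ N ((le_max_right _ _).trans hNN)
  have hΛN : 1 ≤ Λ ^ N := one_le_pow₀ hΛ1.le
  have hle : (p : ℝ) * N *
      (σ * -Real.log (modulusInv A ω (κ / 2 ^ N) / (κ / 2 ^ N)) + 1) < n := by
    rw [hNl]
    have h1 : σ * -(-(c * Λ ^ N) - Real.log κ + N * Real.log 2) + 1 ≤ D * Λ ^ N := by
      have h2 : Real.log κ ≤ |Real.log κ| * Λ ^ N :=
        (le_abs_self _).trans (le_mul_of_one_le_right (abs_nonneg _) hΛN)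
      have h3 : 0 ≤ N * Real.log 2 := by positivity
      have h4 : σ * -(-(c * Λ ^ N) - Real.log κ + N * Real.log 2) ≤
          σ * (c * Λ ^ N + |Real.log κ| * Λ ^ N) := by
        gcongr
        linarith
      rw [hD]
      linarith
    calc (p : ℝ) * N * (σ * -(-(c * Λ ^ N) - Real.log κ + N * Real.log 2) + 1)
        ≤ p * N * (D * Λ ^ N) := by gcongr
      _ ≤ (p * D + 1) * (N * Λ ^ N) := by
        have : 0 ≤ N * Λ ^ N := by positivity
        linarith
      _ < n := hn
  refine (hmain n N hN1 (dNumber_mul_lt hle)).trans ?_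
  have hpos : 0 < modulusInv A ω (κ / 2 ^ N) / (κ / 2 ^ N) :=
    div_pos (hω.inv_pos (by positivity) ((hκN N).trans hκA)) (by positivity)
  rw [← Real.exp_log hpos, hNl, ← Real.exp_half, mul_assoc, ← Real.exp_add]
  gcongr
  linarith

end SpecialModuli

end

/-! ### The theorem -/

theorem theorem2p3 (φ : ℂ → ℂ) (hφ : IsDiskAlgebraSymbol φ)
    (p : ℕ) (ξ : Fin p → ℂ) (hξ : Function.Injective ξ)
    (hcontact : φ '' Metric.closedBall 0 1 ∩ Metric.sphere 0 1 = Set.range ξ)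
    (A : ℝ) (ω : ℝ → ℝ) (hω : IsModulusOfContinuity A ω)
    (hω' : Tendsto (fun h : ℝ => ω h / h) (𝓝[>] 0) atTop)
    (hreg : IsGloballyRegular φ ξ A ω) :
    ∃ T : HardyH2 →L[ℂ] HardyH2, IsCompositionOperator φ T ∧
      (∃ κ > 0, ∃ σ > 0, ∃ K > 0, κ ≤ ω A ∧ ∀ q : ℕ, 1 ≤ q →
        ∃ N : ℕ, IsNq p (dNumber A ω σ κ) q N ∧
          approxNumber q T ≤ K * Real.sqrt (modulusInv A ω (κ / 2 ^ N) / (κ / 2 ^ N))) ∧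
      (∀ θ : ℝ, 0 < θ → θ < 1 → (∀ᶠ h in 𝓝[>] (0 : ℝ), ω h = h ^ θ) →
        ∃ a > 0, ∃ β > 0, ∀ n : ℕ, 1 ≤ n →
          approxNumber n T ≤ a * Real.exp (-β * Real.sqrt n)) ∧
      (∀ α : ℝ, 0 < α → α ≤ 1 →
        (∀ᶠ h in 𝓝[>] (0 : ℝ), ω h = 1 / Real.log (1 / h) ^ α) →
        ∃ a > 0, ∃ β > 0, ∀ n : ℕ, 2 ≤ n →
          approxNumber n T ≤ a * Real.exp (-β * n / Real.log n)) := by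
  have hξ1 : ∀ j, ‖ξ j‖ = 1 := fun j => by
    have h : ξ j ∈ φ '' Metric.closedBall 0 1 ∩ Metric.sphere 0 1 := hcontact ▸ mem_range_self j
    simpa using h.2
  -- The covering of the line by arcs forces at least one contact point.
  have hp : 1 ≤ p := by
    obtain ⟨r, -, hcov, -⟩ := hreg
    obtain ⟨j, -⟩ := hcov 0
    exact j.pos
  obtain ⟨T, hT, κ, hκ, σ, hσ, K, hK, hκA, hinv, hmain⟩ :=
    exists_approxNumber_le hφ hξ1 hω hω' hreg
  have hTn : ∀ n, 1 ≤ n → approxNumber n T ≤ ‖T‖ := fun n hn => approxNumber_le_norm hn T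
  refine ⟨T, hT, ⟨κ, hκ, σ, hσ, ?_⟩, fun θ hθ0 hθ1 h => ?_, fun α hα _ h => ?_⟩
  · have hinv0 : ∀ N : ℕ, 0 < modulusInv A ω (κ / 2 ^ N) := fun N =>
      hω.inv_pos (by positivity)
        ((div_le_self hκ.le (one_le_pow₀ (by norm_num))).trans hκA)
    have hd : ∀ N, 1 ≤ dNumber A ω σ κ N := fun N => by
      have h1 : 0 ≤ Real.log ((κ / 2 ^ N) / modulusInv A ω (κ / 2 ^ N)) :=
        Real.log_nonneg ((one_le_div (hinv0 N)).2 (hinv N))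
      have := Int.floor_nonneg.2 (mul_nonneg hσ.le h1)
      rw [dNumber]
      linarith
    -- When no integer qualifies, `N_q = 1` and only `a_q ≤ ‖T‖` is available; adding `‖T‖ / s` to
    -- `K` covers this case.
    set s := √(modulusInv A ω (κ / 2 ^ 1) / (κ / 2 ^ 1)) with hs
    have hs0 : 0 < s := Real.sqrt_pos.2 (div_pos (hinv0 1) (by positivity))
    refine ⟨K + ‖T‖ / s, by positivity, hκA, fun q hq => ?_⟩
    obtain ⟨N, hN⟩ := exists_isNq hp hd q
    refine ⟨N, hN, ?_⟩
    rcases hN with hN | ⟨-, rfl⟩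
    · refine (hmain q N hN.1.1 hN.1.2).trans ?_
      gcongr
      exact le_add_of_nonneg_right (by positivity)
    · refine (hTn q hq).trans ?_
      rw [← hs, add_mul, div_mul_cancel₀ _ hs0.ne']
      exact le_add_of_nonneg_left (by positivity)
  · exact hω.exists_le_exp_of_rpow hθ0 hθ1 h hκ hκA hσ hK (norm_nonneg T) hTn hmain
  · exact hω.exists_le_exp_of_log hα h hκ hκA hσ hK (norm_nonneg T) hTn hmain
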